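/- Let $R$ be a finite commutative ring with identity. Its zero-divisor graph $\Gamma(R)$ is the simple graph whose vertices are the nonzero zero-divisors of $R$, two distinct vertices $u,v$ being adjacent if and only if $uv=0$. A nonempty set $S$ of vertices of a finite graph is a global offensive alliance if every vertex $v\notin S$ has at least one more neighbour in $S$ than it has outside $S$; $\gamma^o$ denotes the minimum cardinality of a global offensive alliance (with $\gamma^o=0$ for the graph without vertices). Theorem. $\gamma^o(\Gamma(R))=2$ if and only if $R$ is isomorphic to one of the following rings: $\mathbb{Z}_3\times k$ with $k$ a field, $k\not\cong\mathbb{Z}_2$; $\mathbb{Z}_2\times\mathbb{Z}_4$; $\mathbb{Z}_2\times\mathbb{Z}_2[X]/(X^2)$; $\mathbb{Z}_{16}$; $\mathbb{Z}_2[X]/(X^4)$; $\mathbb{Z}_4[X]/(2X,\,X^3-2)$; $\mathbb{Z}_4[X]/(X^2-2)$; $\mathbb{Z}_4[X]/(X^2+2X+2)$; $\mathbb{F}_4[X]/(X^2)$; $\mathbb{Z}_4[X]/(X^2+X+1)$; $\mathbb{Z}_2[X,Y]/(X,Y)^2$; $\mathbb{Z}_4[X]/(2,X)^2$; $\mathbb{Z}_{27}$;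 $\mathbb{Z}_3[X]/(X^3)$; $\mathbb{Z}_9[X]/(X^2-3,\,3X)$; $\mathbb{Z}_9[X]/(X^2-6,\,3X)$; $\mathbb{Z}_{25}$; $\mathbb{Z}_5[X]/(X^2)$. -/

import Mathlib

open scoped Polynomial

universe u

namespace SimpleGraph

/-- `S` is a global offensive alliance of the finite graph `G`: it is nonempty, and each vertex
outside `S` has at least one more neighbour in `S` than it has outside `S`. -/
def IsGlobalOffensiveAlliance {V : Type*} [Finite V] (G : SimpleGraph V) (S : Set V) : Prop :=
  S.Nonempty ∧ ∀ v ∉ S, (G.neighborSet v ∩ Sᶜ).ncard + 1 ≤ (G.neighborSet v ∩ S).ncard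

/-- The global offensive alliance number: the minimum cardinality of a global offensive alliance.
The whole vertex set is one if there is a vertex at all; the graph without vertices has none,
and gets the value `0`. -/
noncomputable def globalOffensiveAllianceNumber {V : Type*} [Finite V] (G : SimpleGraph V) : ℕ :=
  sInf {n : ℕ | ∃ S : Set V, G.IsGlobalOffensiveAlliance S ∧ S.ncard = n}

end SimpleGraph

/-- The set `Z(R)*` of nonzero zero-divisors of `R`. -/
def properZeroDivisors (R : Type*) [CommRing R] : Set R :=
  {x | x ≠ 0 ∧ ∃ y, y ≠ 0 ∧ x * y = 0}

/-- The zero-divisor graph: the vertices are the nonzero zero-divisors, and distinct vertices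
are adjacent if and only if their product is zero. -/
def zeroDivisorGraph (R : Type*) [CommRing R] : SimpleGraph (properZeroDivisors R) where
  Adj u v := u ≠ v ∧ (u : R) * (v : R) = 0
  symm := ⟨fun _ _ h => ⟨h.1.symm, by rw [mul_comm]; exact h.2⟩⟩
  loopless := ⟨fun _ h => h.1 rfl⟩

-- A vertex outside a pair `{a, b}` has at most two neighbours in it. The alliance condition
-- therefore allows it at most one neighbour outside, and that one only if it is adjacent to both
-- `a` and `b`. A one-element alliance is the centre of a star. So the number is `2` exactly when
-- such a pair exists and the graph is not a star; `HasAllianceTwo` states this through products,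
-- and it is invariant under isomorphism.
--
-- A finite ring that is not local splits as `A × B` along an idempotent. If `B` has at least four
-- elements, every `(r, 0)` with `r` a unit lies in the alliance (`IsAlliancePair.isUnit_prod_mem`),
-- which forces one factor to have at most three elements. If `A` has three, a nonzero zero-divisor
-- `y` of `B` would leave `(1, y)` with no neighbour in the alliance, so `B` is a field. If `A` has
-- two, `B` has a maximal ideal `{0, c}` with residue field of order two. Products of a field with
-- the field of two elements give stars.
--
-- Let `R` be local with maximal ideal `m`; its socle, the annihilator of `m`, is nonzero. A nonzero
-- socle element outside the alliance is adjacent to all other vertices, so `m` has four or five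
-- elements, and `m ^ 2 = 0` (`IsAlliancePair.sq_zero_of_socle`). Otherwise the socle lies in `{0,
-- a, b}` and the residue field has two or three elements. The count `|R| = |ann v| * |vR|` then
-- shows that a suitable vertex generates `m`, so `R` is a chain ring; its index of nilpotency is
-- `4` or `3` respectively.
--
-- It remains to name the rings. In a chain ring every nonzero ideal contains the last nonzero power
-- of the generator, so injectivity of a homomorphism is tested on one element. With residue field
-- `ℤ/p`, surjectivity follows from expansion in powers of the generator with integer digits. The
-- presentations arise from writing `p` as a unit times a power of the generator. In the remaining
-- square-zero cases one lifts the residue field of order four, or computes with linear forms.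

universe v

/-! ### Alliances with one and two vertices in an arbitrary finite graph. -/

namespace SimpleGraph

variable {V : Type*} [Finite V] {G : SimpleGraph V}

/-- One neighbour inside leaves no room for a neighbour outside: the graph is a star with centre
`a`. -/
theorem isGlobalOffensiveAlliance_singleton_iff {a : V} :
    G.IsGlobalOffensiveAlliance {a} ↔ ∀ v, v ≠ a → G.Adj v a ∧ ∀ w, G.Adj v w → w = a := by
  have key : ∀ v, (G.neighborSet v ∩ ({a} : Set V)ᶜ).ncard + 1 ≤
      (G.neighborSet v ∩ {a}).ncard ↔ G.Adj v a ∧ ∀ w, G.Adj v w → w = a := by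
    intro v
    constructor
    · intro h
      have h1 : (G.neighborSet v ∩ {a}).ncard ≤ 1 :=
        (Set.ncard_le_ncard Set.inter_subset_right).trans (Set.ncard_singleton a).le
      constructor
      · have : (G.neighborSet v ∩ {a}).Nonempty := by
          rw [← Set.ncard_pos]; omega
        obtain ⟨x, hx, rfl⟩ := this
        exact hx
      · intro w hw
        by_contra hne
        have : 0 < (G.neighborSet v ∩ ({a} : Set V)ᶜ).ncard :=
          (Set.ncard_pos).2 ⟨w, hw, hne⟩
        omega
    · rintro ⟨h1, h2⟩
      have e1 : G.neighborSet v ∩ ({a} : Set V)ᶜ = ∅ := by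
        ext w
        simp only [Set.mem_inter_iff, mem_neighborSet, Set.mem_compl_iff, Set.mem_singleton_iff,
          Set.mem_empty_iff_false, iff_false, not_and, not_not]
        exact h2 w
      have e2 : G.neighborSet v ∩ {a} = {a} := Set.inter_eq_right.2 (by simpa using h1)
      rw [e1, e2]; simp
  simp only [IsGlobalOffensiveAlliance, key, Set.singleton_nonempty, true_and,
    Set.mem_singleton_iff, ne_eq]

/-- With `i ≤ 2` neighbours inside and `o` outside, `o + 1 ≤ i` means `i ≥ 1`, `o ≤ 1`, and `i = 2`
as soon as `o > 0`. The three clauses express this without cardinalities. -/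
theorem isGlobalOffensiveAlliance_pair_iff {a b : V} (hab : a ≠ b) :
    G.IsGlobalOffensiveAlliance {a, b} ↔ ∀ v, v ≠ a → v ≠ b →
      (G.Adj v a ∨ G.Adj v b) ∧
      (∀ w, G.Adj v w → w ≠ a → w ≠ b → G.Adj v a ∧ G.Adj v b) ∧
      ∀ w w', G.Adj v w → w ≠ a → w ≠ b → G.Adj v w' → w' ≠ a → w' ≠ b → w = w' := by
  have key : ∀ v, (G.neighborSet v ∩ ({a, b} : Set V)ᶜ).ncard + 1 ≤
      (G.neighborSet v ∩ {a, b}).ncard ↔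
      (G.Adj v a ∨ G.Adj v b) ∧
      (∀ w, G.Adj v w → w ≠ a → w ≠ b → G.Adj v a ∧ G.Adj v b) ∧
      ∀ w w', G.Adj v w → w ≠ a → w ≠ b → G.Adj v w' → w' ≠ a → w' ≠ b → w = w' := by
    intro v
    set O := G.neighborSet v ∩ ({a, b} : Set V)ᶜ with hO
    have memO : ∀ w, w ∈ O ↔ G.Adj v w ∧ w ≠ a ∧ w ≠ b := by
      intro w; simp [hO, not_or]
    have hO1 : O.ncard ≤ 1 ↔
        ∀ w w', G.Adj v w → w ≠ a → w ≠ b → G.Adj v w' → w' ≠ a → w' ≠ b → w = w' := by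
      rw [Set.ncard_le_one_iff]
      constructor
      · intro h w w' h1 h2 h3 h4 h5 h6
        exact h ((memO w).2 ⟨h1, h2, h3⟩) ((memO w').2 ⟨h4, h5, h6⟩)
      · intro h w w' h1 h2
        rw [memO] at h1 h2
        exact h w w' h1.1 h1.2.1 h1.2.2 h2.1 h2.2.1 h2.2.2
    have hO0 : O.ncard = 0 ↔ ∀ w, G.Adj v w → w ≠ a → w ≠ b → False := by
      rw [Set.ncard_eq_zero, Set.eq_empty_iff_forall_notMem]
      simp only [memO, not_and]
    by_cases ha : G.Adj v a <;> by_cases hb : G.Adj v b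
    · have e : G.neighborSet v ∩ {a, b} = {a, b} := Set.inter_eq_right.2 (by
        intro w hw; rcases hw with rfl | rfl <;> assumption)
      rw [e, Set.ncard_pair hab, ← hO1]
      simp only [ha, hb, or_self, and_self, implies_true, true_and]
      omega
    · have e : G.neighborSet v ∩ {a, b} = {a} := by
        ext w
        simp only [Set.mem_inter_iff, mem_neighborSet, Set.mem_insert_iff, Set.mem_singleton_iff]
        constructor
        · rintro ⟨h, rfl | rfl⟩
          · rfl
          · exact absurd h hb
        · rintro rfl; exact ⟨ha, Or.inl rfl⟩
      rw [e, Set.ncard_singleton, ← hO1]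
      simp only [ha, hb, and_false, or_false, true_and, ← hO0]
      omega
    · have e : G.neighborSet v ∩ {a, b} = {b} := by
        ext w
        simp only [Set.mem_inter_iff, mem_neighborSet, Set.mem_insert_iff, Set.mem_singleton_iff]
        constructor
        · rintro ⟨h, rfl | rfl⟩
          · exact absurd h ha
          · rfl
        · rintro rfl; exact ⟨hb, Or.inr rfl⟩
      rw [e, Set.ncard_singleton, ← hO1]
      simp only [ha, hb, false_and, false_or, true_and, ← hO0]
      omega
    · have e : G.neighborSet v ∩ {a, b} = ∅ := by
        ext w
        simp only [Set.mem_inter_iff, mem_neighborSet, Set.mem_insert_iff, Set.mem_singleton_iff,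
          Set.mem_empty_iff_false, iff_false]
        rintro ⟨h, rfl | rfl⟩ <;> contradiction
      rw [e]
      simp [ha, hb]
  simp only [IsGlobalOffensiveAlliance, key, Set.insert_nonempty, true_and,
    Set.mem_singleton_iff, Set.mem_insert_iff, not_or, ne_eq, and_imp]

theorem globalOffensiveAllianceNumber_eq_two_iff :
    G.globalOffensiveAllianceNumber = 2 ↔
      (∃ a b : V, a ≠ b ∧ G.IsGlobalOffensiveAlliance {a, b}) ∧
        ∀ a : V, ¬ G.IsGlobalOffensiveAlliance {a} := by
  unfold globalOffensiveAllianceNumber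
  constructor
  · intro h
    -- The infimum of the empty set is `0`, so the value `2` is attained by an actual alliance.
    have hne : {n : ℕ | ∃ S : Set V, G.IsGlobalOffensiveAlliance S ∧ S.ncard = n}.Nonempty := by
      by_contra h0
      rw [Set.not_nonempty_iff_eq_empty] at h0
      rw [h0] at h
      simp at h
    have hmem := Nat.sInf_mem hne
    rw [h] at hmem
    obtain ⟨S, hS, hcard⟩ := hmem
    obtain ⟨a, b, hab, rfl⟩ := Set.ncard_eq_two.1 hcard
    refine ⟨⟨a, b, hab, hS⟩, fun c hc => ?_⟩
    have : sInf {n : ℕ | ∃ S : Set V, G.IsGlobalOffensiveAlliance S ∧ S.ncard = n} ≤ 1 :=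
      Nat.sInf_le ⟨{c}, hc, Set.ncard_singleton c⟩
    omega
  · rintro ⟨⟨a, b, hab, hS⟩, h1⟩
    have hmem2 : 2 ∈ {n : ℕ | ∃ S : Set V, G.IsGlobalOffensiveAlliance S ∧ S.ncard = n} :=
      ⟨_, hS, Set.ncard_pair hab⟩
    apply le_antisymm (Nat.sInf_le hmem2)
    obtain ⟨S, hS, hcard⟩ := Nat.sInf_mem ⟨2, hmem2⟩
    rw [← hcard]
    have h0 : 0 < S.ncard := (Set.ncard_pos).2 hS.1
    by_contra hlt
    obtain ⟨c, rfl⟩ := Set.ncard_eq_one.1 (show S.ncard = 1 by omega)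
    exact h1 c hS

end SimpleGraph

/-- `{a, b}` is a global offensive alliance of the zero-divisor graph, in terms of products. -/
def IsAlliancePair {R : Type*} [CommRing R] (a b : R) : Prop :=
  a ∈ properZeroDivisors R ∧ b ∈ properZeroDivisors R ∧ a ≠ b ∧
    ∀ v ∈ properZeroDivisors R, v ≠ a → v ≠ b →
      (v * a = 0 ∨ v * b = 0) ∧
      (∀ w ∈ properZeroDivisors R, w ≠ v → v * w = 0 → w ≠ a → w ≠ b → v * a = 0 ∧ v * b = 0) ∧
      ∀ w ∈ properZeroDivisors R, ∀ w' ∈ properZeroDivisors R, w ≠ v → v * w = 0 → w ≠ a →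
        w ≠ b → w' ≠ v → v * w' = 0 → w' ≠ a → w' ≠ b → w = w'

/-- The zero-divisor graph is a star with centre `a`, in terms of products. -/
def IsStarCenter {R : Type*} [CommRing R] (a : R) : Prop :=
  a ∈ properZeroDivisors R ∧ ∀ v ∈ properZeroDivisors R, v ≠ a →
    v * a = 0 ∧ ∀ w ∈ properZeroDivisors R, w ≠ v → v * w = 0 → w = a

/-- The zero-divisor graph has an alliance with two elements, and none with one. -/
def HasAllianceTwo (R : Type*) [CommRing R] : Prop :=
  (∃ a b : R, IsAlliancePair a b) ∧ ∀ a : R, ¬ IsStarCenter a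

theorem globalOffensiveAllianceNumber_zeroDivisorGraph_eq_two_iff {R : Type*} [CommRing R]
    [Finite R] :
    (zeroDivisorGraph R).globalOffensiveAllianceNumber = 2 ↔ HasAllianceTwo R := by
  rw [SimpleGraph.globalOffensiveAllianceNumber_eq_two_iff]
  unfold HasAllianceTwo
  refine and_congr ⟨?_, ?_⟩ ⟨?_, ?_⟩
  · rintro ⟨⟨a, ha⟩, ⟨b, hb⟩, hab, h⟩
    rw [SimpleGraph.isGlobalOffensiveAlliance_pair_iff hab] at h
    refine ⟨a, b, ha, hb, fun e => hab (Subtype.ext e), fun v hv hva hvb => ?_⟩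
    obtain ⟨h1, h2, h3⟩ := h ⟨v, hv⟩ (by simpa using hva) (by simpa using hvb)
    refine ⟨h1.imp And.right And.right, fun w hw e1 e2 e3 e4 => ?_,
      fun w hw w' hw' e1 e2 e3 e4 f1 f2 f3 f4 => ?_⟩
    · exact (h2 ⟨w, hw⟩ ⟨fun e => e1 (congrArg Subtype.val e).symm, e2⟩ (by simpa using e3)
        (by simpa using e4)).imp And.right And.right
    · exact congrArg Subtype.val (h3 ⟨w, hw⟩ ⟨w', hw'⟩
        ⟨fun e => e1 (congrArg Subtype.val e).symm, e2⟩ (by simpa using e3)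
        (by simpa using e4) ⟨fun e => f1 (congrArg Subtype.val e).symm, f2⟩ (by simpa using f3)
        (by simpa using f4))
  · rintro ⟨a, b, ha, hb, hab, h⟩
    have hab' : (⟨a, ha⟩ : properZeroDivisors R) ≠ ⟨b, hb⟩ := by simpa using hab
    refine ⟨⟨a, ha⟩, ⟨b, hb⟩, hab', ?_⟩
    rw [SimpleGraph.isGlobalOffensiveAlliance_pair_iff hab']
    rintro ⟨v, hv⟩ hva hvb
    obtain ⟨h1, h2, h3⟩ := h v hv (by simpa using hva) (by simpa using hvb)
    refine ⟨h1.imp (⟨hva, ·⟩) (⟨hvb, ·⟩), fun w e2 e3 e4 => ?_,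
      fun w w' e2 e3 e4 f2 f3 f4 => ?_⟩
    · exact (h2 w w.2 (fun e => e2.1 (Subtype.ext e.symm)) e2.2 (fun e => e3 (Subtype.ext e))
        (fun e => e4 (Subtype.ext e))).imp (⟨hva, ·⟩) (⟨hvb, ·⟩)
    · exact Subtype.ext (h3 w w.2 w' w'.2 (fun e => e2.1 (Subtype.ext e.symm)) e2.2
        (fun e => e3 (Subtype.ext e)) (fun e => e4 (Subtype.ext e))
        (fun e => f2.1 (Subtype.ext e.symm)) f2.2
        (fun e => f3 (Subtype.ext e)) (fun e => f4 (Subtype.ext e)))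
  · rintro h a ⟨ha, hs⟩
    apply h ⟨a, ha⟩
    rw [SimpleGraph.isGlobalOffensiveAlliance_singleton_iff]
    rintro ⟨v, hv⟩ hva
    obtain ⟨h1, h2⟩ := hs v hv (by simpa using hva)
    exact ⟨⟨hva, h1⟩, fun w hw => Subtype.ext (h2 w w.2 (fun e => hw.1 (Subtype.ext e.symm)) hw.2)⟩
  · rintro h ⟨a, ha⟩ hs
    rw [SimpleGraph.isGlobalOffensiveAlliance_singleton_iff] at hs
    refine h a ⟨ha, fun v hv hva => ?_⟩
    obtain ⟨h1, h2⟩ := hs ⟨v, hv⟩ (by simpa using hva)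
    exact ⟨h1.2, fun w hw e1 e2 => congrArg Subtype.val
      (h2 ⟨w, hw⟩ ⟨fun e => e1 (congrArg Subtype.val e).symm, e2⟩)⟩

theorem IsAlliancePair.symm {R : Type*} [CommRing R] {a b : R} (h : IsAlliancePair a b) :
    IsAlliancePair b a := by
  obtain ⟨ha, hb, hab, h⟩ := h
  refine ⟨hb, ha, hab.symm, fun v hv hvb hva => ?_⟩
  obtain ⟨h1, h2, h3⟩ := h v hv hva hvb
  exact ⟨h1.symm, fun w hw e1 e2 e3 e4 => (h2 w hw e1 e2 e4 e3).symm,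
    fun w hw w' hw' e1 e2 e3 e4 f1 f2 f3 f4 => h3 w hw w' hw' e1 e2 e4 e3 f1 f2 f4 f3⟩

/-! ### Invariance under ring isomorphisms. -/

section Transport

variable {R : Type u} {Q : Type v} [CommRing R] [CommRing Q]

theorem map_mem_properZeroDivisors_iff (e : R ≃+* Q) {x : R} :
    e x ∈ properZeroDivisors Q ↔ x ∈ properZeroDivisors R := by
  unfold properZeroDivisors
  simp only [Set.mem_ofPred_eq, e.surjective.exists, ← map_mul, map_ne_zero_iff e e.injective,
    map_eq_zero_iff e e.injective]

theorem IsAlliancePair.map {a b : R} (hab : IsAlliancePair a b) (e : R ≃+* Q) :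
    IsAlliancePair (e a) (e b) := by
  unfold IsAlliancePair at hab ⊢
  simpa only [e.surjective.forall, ← map_mul, map_eq_zero_iff e e.injective, ne_eq,
    e.injective.eq_iff, map_mem_properZeroDivisors_iff] using hab

theorem HasAllianceTwo.of_ringEquiv (h : HasAllianceTwo R) (e : R ≃+* Q) : HasAllianceTwo Q := by
  obtain ⟨⟨a, b, hab⟩, hs⟩ := h
  refine ⟨⟨e a, e b, hab.map e⟩, ?_⟩
  rw [e.surjective.forall]
  intro a
  have := hs a
  unfold IsStarCenter at this ⊢
  simpa only [e.surjective.forall, ← map_mul, map_eq_zero_iff e e.injective, ne_eq,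
    e.injective.eq_iff, map_mem_properZeroDivisors_iff] using this

end Transport

/-! ### Chain rings and chain rings with prime residue field. -/

/-- Every element is a unit or a multiple of `x`, and `n + 1` is the nilpotency index of `x`. -/
structure IsUniformizer {R : Type*} [CommRing R] (x : R) (n : ℕ) : Prop where
  pow_eq_zero : x ^ (n + 1) = 0
  pow_ne_zero : x ^ n ≠ 0
  isUnit_or_dvd : ∀ r : R, IsUnit r ∨ x ∣ r

namespace IsUniformizer

variable {R : Type u} {Q : Type v} [CommRing R] [CommRing Q] {x : R} {n : ℕ}

/-- Factors `x` are split off until the cofactor is a unit; `n + 1` factors would make `r` zero. -/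
theorem exists_eq_unit_mul_pow (h : IsUniformizer x n) {r : R} (hr : r ≠ 0) :
    ∃ i ≤ n, ∃ w, IsUnit w ∧ r = w * x ^ i := by
  have key : ∀ k, (∃ i < k, ∃ w, IsUnit w ∧ r = w * x ^ i) ∨ x ^ k ∣ r := by
    intro k
    induction k with
    | zero => right; simp
    | succ k ih =>
      rcases ih with ⟨i, hi, w, hw, e⟩ | ⟨s, hs⟩
      · exact Or.inl ⟨i, by omega, w, hw, e⟩
      · rcases h.isUnit_or_dvd s with hu | ⟨t, rfl⟩
        · exact Or.inl ⟨k, by omega, s, hu, by rw [hs, mul_comm]⟩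
        · exact Or.inr ⟨t, by rw [hs]; ring⟩
  rcases key (n + 1) with ⟨i, hi, w⟩ | h1
  · exact ⟨i, by omega, w⟩
  · rw [h.pow_eq_zero, zero_dvd_iff] at h1
    exact absurd h1 hr

theorem dvd_pow (h : IsUniformizer x n) {r : R} (hr : r ≠ 0) : r ∣ x ^ n := by
  obtain ⟨i, hi, w, hw, rfl⟩ := h.exists_eq_unit_mul_pow hr
  exact (hw.mul_left_dvd).2 (pow_dvd_pow x hi)

theorem not_isUnit (h : IsUniformizer x n) : ¬ IsUnit x := by
  intro hu
  have := (hu.pow (n + 1))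
  rw [h.pow_eq_zero] at this
  exact h.pow_ne_zero (by rw [← mul_one (x ^ n), ← this.mul_left_eq_zero]; simp)

theorem isUnit_iff_not_dvd (h : IsUniformizer x n) {r : R} : IsUnit r ↔ ¬ x ∣ r :=
  ⟨fun hu hd => h.not_isUnit (isUnit_of_dvd_unit hd hu), (h.isUnit_or_dvd r).resolve_right⟩

theorem pow_dvd_of_pow_mul_eq_zero (h : IsUniformizer x n) {i : ℕ} {w : R}
    (hw : x ^ i * w = 0) : x ^ (n + 1 - i) ∣ w := by
  by_cases h0 : w = 0
  · rw [h0]; exact dvd_zero _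
  obtain ⟨j, hj, w', hw', rfl⟩ := h.exists_eq_unit_mul_pow h0
  have h1 : x ^ (i + j) = 0 := by
    rw [← hw'.mul_right_eq_zero, pow_add, ← hw]; ring
  have h2 : n < i + j := by
    by_contra hlt
    apply h.pow_ne_zero
    rw [← Nat.add_sub_of_le (not_lt.1 hlt), pow_add, h1, zero_mul]
  exact (pow_dvd_pow x (by omega)).mul_left _

/-- Every nonzero element divides `x ^ n`, so a nonzero kernel would contain `x ^ n`. -/
theorem injective (h : IsUniformizer x n) (f : R →+* Q) (hf : f x ^ n ≠ 0) :
    Function.Injective f := by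
  rw [injective_iff_map_eq_zero]
  intro r hr
  by_contra h0
  obtain ⟨s, hs⟩ := h.dvd_pow h0
  exact hf (by rw [← map_pow, hs, map_mul, hr, zero_mul])

end IsUniformizer

/-- Successive approximation: an error divisible by `x ^ k` is corrected by `x ^ k` times a digit
from the range, and the process ends because `x` is nilpotent. -/
theorem RingHom.surjective_of_forall_dvd_sub {R : Type u} {Q : Type v} [CommRing R] [CommRing Q]
    (f : Q →+* R) {x : R} (hx : IsNilpotent x) (hxf : x ∈ f.range)
    (h : ∀ r, ∃ c ∈ f.range, x ∣ r - c) : Function.Surjective f := by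
  obtain ⟨n, hn⟩ := hx
  have key : ∀ k, ∀ r, ∃ c ∈ f.range, x ^ k ∣ r - c := by
    intro k
    induction k with
    | zero => intro r; exact ⟨0, zero_mem _, by simp⟩
    | succ k ih =>
      intro r
      obtain ⟨c, hc, s, hs⟩ := ih r
      obtain ⟨d, hd, t, ht⟩ := h s
      refine ⟨c + x ^ k * d, add_mem hc (mul_mem (pow_mem hxf k) hd), t, ?_⟩
      calc r - (c + x ^ k * d) = x ^ k * (s - d) := by rw [mul_sub, ← hs]; ring
        _ = x ^ (k + 1) * t := by rw [ht]; ring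
  intro r
  obtain ⟨c, hc, hd⟩ := key n r
  rw [hn, zero_dvd_iff, sub_eq_zero] at hd
  rw [hd]
  exact hc

/-- `x` generates a maximal ideal with residue field `ℤ/p`, and `n + 1` is the nilpotency index
of `x`. -/
structure IsPrimeUniformizer {R : Type*} [CommRing R] (p : ℕ) (x : R) (n : ℕ) : Prop where
  prime : p.Prime
  pow_eq_zero : x ^ (n + 1) = 0
  pow_ne_zero : x ^ n ≠ 0
  dvd_prime : x ∣ (p : R)
  exists_dvd_sub : ∀ r : R, ∃ c : ℤ, x ∣ r - c

namespace IsPrimeUniformizer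

variable {R : Type u} {Q : Type v} [CommRing R] [CommRing Q] {p : ℕ} {x : R} {n : ℕ}

/-- The digit `c` of `r` is either divisible by `p`, hence by `x`, or invertible modulo `p`; in the
latter case Bézout makes a multiple of `r` equal to `1` plus a nilpotent. -/
theorem isUniformizer (h : IsPrimeUniformizer p x n) : IsUniformizer x n := by
  refine ⟨h.pow_eq_zero, h.pow_ne_zero, fun r => ?_⟩
  obtain ⟨c, s, hs⟩ := h.exists_dvd_sub r
  obtain ⟨t, ht⟩ := h.dvd_prime
  by_cases hc : (p : ℤ) ∣ c
  · right
    obtain ⟨d, rfl⟩ := hc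
    refine ⟨s + t * d, ?_⟩
    rw [sub_eq_iff_eq_add] at hs
    rw [hs]; push_cast; rw [ht]; ring
  · left
    obtain ⟨a, b, hab⟩ := ((Nat.prime_iff_prime_int.1 h.prime).coprime_iff_not_dvd.2 hc)
    have hr : r * b = 1 + x * (s * b - t * a) := by
      have h1 : (a : R) * p + b * c = 1 := by exact_mod_cast congrArg (Int.cast : ℤ → R) hab
      rw [sub_eq_iff_eq_add] at hs
      rw [ht] at h1
      rw [hs]
      linear_combination h1
    have : IsUnit (r * b) := by
      rw [hr, add_comm]
      refine IsNilpotent.isUnit_add_one ⟨n + 1, ?_⟩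
      rw [mul_pow, h.pow_eq_zero, zero_mul]
    exact isUnit_of_mul_isUnit_left this

theorem isNilpotent (h : IsPrimeUniformizer p x n) : IsNilpotent x := ⟨_, h.pow_eq_zero⟩

theorem bijective (h : IsPrimeUniformizer p x n) {y : Q} (hy : IsPrimeUniformizer p y n)
    (f : Q →+* R) (hf : f y = x) : Function.Bijective f := by
  refine ⟨hy.isUniformizer.injective f (by rw [hf]; exact h.pow_ne_zero),
    f.surjective_of_forall_dvd_sub h.isNilpotent ⟨y, hf⟩ fun r => ?_⟩
  obtain ⟨c, hc⟩ := h.exists_dvd_sub r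
  exact ⟨c, ⟨c, by simp⟩, hc⟩

end IsPrimeUniformizer

theorem ZMod.exists_ringHom {R : Type*} [CommRing R] {m : ℕ} (hm : (m : R) = 0) :
    Nonempty (ZMod m →+* R) :=
  ⟨ZMod.castHom ((ringChar.spec R m).1 hm) R⟩

theorem isPrimeUniformizer_zmod {p : ℕ} (hp : p.Prime) (n : ℕ) :
    IsPrimeUniformizer p (p : ZMod (p ^ (n + 1))) n := by
  refine ⟨hp, ?_, ?_, dvd_rfl, fun r => ?_⟩
  · exact_mod_cast ZMod.natCast_self (p ^ (n + 1))
  · intro h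
    have : ((p ^ n : ℕ) : ZMod (p ^ (n + 1))) = 0 := by exact_mod_cast h
    rw [ZMod.natCast_eq_zero_iff, Nat.pow_dvd_pow_iff_le_right hp.one_lt] at this
    omega
  · obtain ⟨c, rfl⟩ := ZMod.intCast_surjective r
    exact ⟨c, by simp⟩

/-- The element `p` is itself a uniformizer: if `x ^ 2` divided `p`, then `x ^ (2 * n)` would divide
`p ^ n`, and `2 * n ≥ n + 1` because `n ≠ 0`. -/
theorem IsPrimeUniformizer.nonempty_ringEquiv_zmod {R : Type u} [CommRing R] {p : ℕ} {x : R}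
    {n : ℕ} (h : IsPrimeUniformizer p x n) (hn : n ≠ 0) (hp : (p : R) ^ n ≠ 0) :
    Nonempty (R ≃+* ZMod (p ^ (n + 1))) := by
  obtain ⟨t, ht⟩ := h.dvd_prime
  have htu : IsUnit t := by
    rcases h.isUniformizer.isUnit_or_dvd t with hu | ⟨s, rfl⟩
    · exact hu
    · exfalso
      apply hp
      obtain ⟨k, rfl⟩ := Nat.exists_eq_succ_of_ne_zero hn
      have e := h.pow_eq_zero
      rw [ht]
      calc (x * (x * s)) ^ k.succ = x ^ (k.succ + 1) * (x ^ k * s ^ k.succ) := by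
            rw [Nat.succ_eq_add_one]; ring
        _ = 0 := by rw [e, zero_mul]
  have hdvd : ∀ r, x ∣ r → (p : R) ∣ r := fun r hr => by
    rw [ht]; exact (htu.mul_right_dvd).2 hr
  have h' : IsPrimeUniformizer p (p : R) n := by
    refine ⟨h.prime, by rw [ht, mul_pow, h.pow_eq_zero, zero_mul], hp, dvd_rfl, fun r => ?_⟩
    obtain ⟨c, hc⟩ := h.exists_dvd_sub r
    exact ⟨c, hdvd _ hc⟩
  obtain ⟨f⟩ := ZMod.exists_ringHom (R := R) (m := p ^ (n + 1)) (by
    push_cast; exact h'.pow_eq_zero)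
  exact ⟨(RingEquiv.ofBijective f
    (h'.bijective (isPrimeUniformizer_zmod h.prime n) f (by simp))).symm⟩

/-! ### Presentations of chain rings as quotients of `(ZMod m)[X]`. -/

section Presentation

variable {m p n : ℕ} {I : Ideal (ZMod m)[X]}

theorem isPrimeUniformizer_mk_X (hp : p.Prime) (hI : (Polynomial.X : (ZMod m)[X]) ^ (n + 1) ∈ I)
    (hpI : ∃ g, (p : (ZMod m)[X]) - Polynomial.X * g ∈ I)
    (hne : (Polynomial.X : (ZMod m)[X]) ^ n ∉ I) :
    IsPrimeUniformizer p (Ideal.Quotient.mk I Polynomial.X) n := by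
  refine ⟨hp, ?_, ?_, ?_, ?_⟩
  · rw [← map_pow]; exact Ideal.Quotient.eq_zero_iff_mem.2 hI
  · rw [← map_pow]; exact fun h => hne (Ideal.Quotient.eq_zero_iff_mem.1 h)
  · obtain ⟨g, hg⟩ := hpI
    refine ⟨Ideal.Quotient.mk I g, ?_⟩
    rw [← map_mul, ← sub_eq_zero, ← map_natCast (Ideal.Quotient.mk I), ← map_sub]
    exact Ideal.Quotient.eq_zero_iff_mem.2 hg
  · intro r
    obtain ⟨f, rfl⟩ := Ideal.Quotient.mk_surjective r
    obtain ⟨c, hc⟩ := ZMod.intCast_surjective (f.coeff 0)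
    refine ⟨c, Ideal.Quotient.mk I f.divX, ?_⟩
    rw [← map_intCast (Ideal.Quotient.mk I), ← map_sub, ← map_mul]
    congr 1
    conv_lhs => rw [← f.divX_mul_X_add]
    rw [← hc]
    simp [mul_comm]

/-- Evaluation at `x` factors through the quotient. It also shows that `X ^ n` survives there, since
`x ^ n ≠ 0`, so both sides have uniformizers of the same index matched by the map. -/
theorem IsPrimeUniformizer.nonempty_ringEquiv_quotient {R : Type u} [CommRing R] {x : R}
    (h : IsPrimeUniformizer p x n) (hm : (m : R) = 0)
    (hI : (Polynomial.X : (ZMod m)[X]) ^ (n + 1) ∈ I)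
    (hpI : ∃ g, (p : (ZMod m)[X]) - Polynomial.X * g ∈ I)
    (hx : ∀ ι : ZMod m →+* R, ∀ f ∈ I, Polynomial.eval₂ ι x f = 0) :
    Nonempty (R ≃+* (ZMod m)[X] ⧸ I) := by
  obtain ⟨ι⟩ := ZMod.exists_ringHom hm
  have hX : (Polynomial.X : (ZMod m)[X]) ^ n ∉ I := fun hmem => by
    have := hx ι _ hmem
    rw [Polynomial.eval₂_pow, Polynomial.eval₂_X] at this
    exact h.pow_ne_zero this
  let f : (ZMod m)[X] ⧸ I →+* R := Ideal.Quotient.lift I (Polynomial.eval₂RingHom ι x) (hx ι)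
  exact ⟨(RingEquiv.ofBijective f (h.bijective
    (isPrimeUniformizer_mk_X h.prime hI hpI hX) f
    ((Ideal.Quotient.lift_mk _ _ _).trans (Polynomial.eval₂_X ι x)))).symm⟩

theorem eval₂_eq_zero_of_mem_span {A R : Type*} [CommRing A] [CommRing R] (ι : A →+* R) (x : R)
    {s : Set A[X]} (hs : ∀ g ∈ s, Polynomial.eval₂ ι x g = 0) :
    ∀ f ∈ Ideal.span s, Polynomial.eval₂ ι x f = 0 := by
  intro f hf
  have : Ideal.span s ≤ RingHom.ker (Polynomial.eval₂RingHom ι x) := Ideal.span_le.2 hs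
  exact this hf

theorem IsPrimeUniformizer.nonempty_ringEquiv_quotient_X_pow {R : Type u} [CommRing R] {x : R}
    (h : IsPrimeUniformizer p x n) (hm : (p : R) = 0) :
    Nonempty (R ≃+* (ZMod p)[X] ⧸ Ideal.span {(Polynomial.X : (ZMod p)[X]) ^ (n + 1)}) := by
  refine h.nonempty_ringEquiv_quotient hm (Ideal.subset_span rfl) ⟨0, by simp⟩ fun ι => ?_
  refine eval₂_eq_zero_of_mem_span ι x ?_
  rintro g rfl
  rw [Polynomial.eval₂_pow, Polynomial.eval₂_X, h.pow_eq_zero]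

theorem isPrimeUniformizer_quotient_X_pow (hp : p.Prime) (n : ℕ) :
    IsPrimeUniformizer p
      (Ideal.Quotient.mk (Ideal.span {(Polynomial.X : (ZMod p)[X]) ^ (n + 1)}) Polynomial.X) n := by
  have := Fact.mk hp
  refine isPrimeUniformizer_mk_X hp (Ideal.subset_span rfl) ⟨0, by simp⟩ fun h => ?_
  rw [Ideal.mem_span_singleton] at h
  exact (Polynomial.monic_X_pow (n + 1)).not_dvd_of_degree_lt
    (Polynomial.monic_X_pow n).ne_zero (by simp; norm_cast; omega) h

end Presentation

/-! ### Local rings: the alliances that exist. -/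

section Graph

variable {R : Type u} [CommRing R]

/-- Every edge of a star contains the centre, and no vertex lies on all three edges of a triangle.
-/
theorem not_isStarCenter_of_triangle {r s t : R} (hr : r ≠ 0) (hs : s ≠ 0) (ht : t ≠ 0)
    (hrs : r ≠ s) (hrt : r ≠ t) (hst : s ≠ t) (ers : r * s = 0) (ert : r * t = 0)
    (est : s * t = 0) (a : R) : ¬ IsStarCenter a := by
  rintro ⟨-, h⟩
  have mr : r ∈ properZeroDivisors R := ⟨hr, s, hs, ers⟩
  have ms : s ∈ properZeroDivisors R := ⟨hs, t, ht, est⟩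
  have mt : t ∈ properZeroDivisors R := ⟨ht, r, hr, by rw [mul_comm]; exact ert⟩
  by_cases hra : r = a
  · by_cases hsa : s = a
    · exact hrs (hra.trans hsa.symm)
    · exact hrt (hra.trans ((h s ms hsa).2 t mt hst.symm est).symm)
  · have hsa := (h r mr hra).2 s ms hrs.symm ers
    have hta := (h r mr hra).2 t mt hrt.symm ert
    exact hst (hsa.trans hta.symm)

theorem IsUniformizer.mem_properZeroDivisors_iff {x : R} {n : ℕ} (h : IsUniformizer x n) {v : R} :
    v ∈ properZeroDivisors R ↔ v ≠ 0 ∧ x ∣ v := by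
  refine and_congr_right fun h0 => ⟨?_, ?_⟩
  · rintro ⟨y, hy, hvy⟩
    refine (h.isUnit_or_dvd v).resolve_left fun hu => hy ?_
    rwa [hu.mul_right_eq_zero] at hvy
  · rintro ⟨s, rfl⟩
    refine ⟨x ^ n, h.pow_ne_zero, ?_⟩
    rw [mul_right_comm, ← pow_succ', h.pow_eq_zero, zero_mul]

namespace IsPrimeUniformizer

variable {x : R} {n : ℕ}

theorem dvd_or_eq_one_add (h : IsPrimeUniformizer 2 x n) (r : R) :
    (∃ s, r = x * s) ∨ ∃ s, r = 1 + x * s := by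
  obtain ⟨c, s, hs⟩ := h.exists_dvd_sub r
  obtain ⟨t, ht⟩ := h.dvd_prime
  rw [sub_eq_iff_eq_add] at hs
  push_cast at ht
  rcases Int.even_or_odd' c with ⟨d, rfl | rfl⟩
  · left; refine ⟨s + t * d, ?_⟩; rw [hs]; push_cast; rw [ht]; ring
  · right; refine ⟨s + t * d, ?_⟩; rw [hs]; push_cast; rw [ht]; ring

theorem dvd_or_eq_one_add_or (h : IsPrimeUniformizer 3 x n) (r : R) :
    (∃ s, r = x * s) ∨ (∃ s, r = 1 + x * s) ∨ ∃ s, r = -1 + x * s := by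
  obtain ⟨c, s, hs⟩ := h.exists_dvd_sub r
  obtain ⟨t, ht⟩ := h.dvd_prime
  rw [sub_eq_iff_eq_add] at hs
  push_cast at ht
  have hc : c = 3 * (c / 3) ∨ c = 1 + 3 * (c / 3) ∨ c = -1 + 3 * (c / 3 + 1) := by omega
  rcases hc with hc | hc | hc <;> rw [hc] at hs <;> push_cast at hs <;> rw [ht] at hs
  · left; exact ⟨s + t * ((c / 3 : ℤ) : R), by rw [hs]; ring⟩
  · right; left; exact ⟨s + t * ((c / 3 : ℤ) : R), by rw [hs]; ring⟩
  · right; right; exact ⟨s + t * (((c / 3 : ℤ) : R) + 1), by rw [hs]; ring⟩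

/-- The alliance is `{x ^ 3, x ^ 2}`. The other vertices are `x ^ 2 + x ^ 3`, whose only neighbours
are these two, and the unit multiples of `x`, whose only neighbour is `x ^ 3`. The first three
vertices form a triangle. -/
theorem hasAllianceTwo_two (h : IsPrimeUniformizer 2 x 3) : HasAllianceTwo R := by
  have h4 : x ^ 4 = 0 := h.pow_eq_zero
  have h3 : x ^ 3 ≠ 0 := h.pow_ne_zero
  have hU := h.isUniformizer
  have h2 : x ^ 2 ≠ 0 := fun e => h3 (by rw [pow_succ, e, zero_mul])
  have h23 : x ^ 2 ≠ x ^ 3 := fun e => h3 (by linear_combination x * e + h4)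
  have h23' : x ^ 2 + x ^ 3 ≠ 0 := fun e => h3 (by linear_combination x * e - h4)
  have mem2 : x ^ 2 ∈ properZeroDivisors R :=
    hU.mem_properZeroDivisors_iff.2 ⟨h2, x, by ring⟩
  have mem3 : x ^ 3 ∈ properZeroDivisors R :=
    hU.mem_properZeroDivisors_iff.2 ⟨h3, x ^ 2, by ring⟩
  have cube : ∀ t, x ^ 3 * t = 0 ∨ x ^ 3 * t = x ^ 3 := by
    intro t
    rcases h.dvd_or_eq_one_add t with ⟨s, rfl⟩ | ⟨s, rfl⟩
    · left; linear_combination s * h4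
    · right; linear_combination s * h4
  have sq : ∀ t, x ^ 2 * t = 0 ∨ x ^ 2 * t = x ^ 3 ∨ x ^ 2 * t = x ^ 2 ∨
      x ^ 2 * t = x ^ 2 + x ^ 3 := by
    intro t
    rcases h.dvd_or_eq_one_add t with ⟨s, rfl⟩ | ⟨s, rfl⟩
    · have : x ^ 2 * (x * s) = x ^ 3 * s := by ring
      rw [this]
      rcases cube s with e | e
      · exact Or.inl e
      · exact Or.inr (Or.inl e)
    · have : x ^ 2 * (1 + x * s) = x ^ 2 + x ^ 3 * s := by ring
      rw [this]
      rcases cube s with e | e <;> rw [e]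
      · simp
      · simp
  refine ⟨⟨x ^ 3, x ^ 2, mem3, mem2, h23.symm, ?_⟩, not_isStarCenter_of_triangle h2 h3 h23' h23
    (fun e => h3 (by linear_combination -e)) (fun e => h2 (by linear_combination -e))
    (by linear_combination x * h4) (by linear_combination (1 + x) * h4)
    (by linear_combination (x + x ^ 2) * h4)⟩
  intro v hv hva hvb
  rw [hU.mem_properZeroDivisors_iff] at hv
  obtain ⟨hv0, s, rfl⟩ := hv
  rcases h.dvd_or_eq_one_add s with ⟨t, rfl⟩ | ⟨t, rfl⟩
  · rw [show x * (x * t) = x ^ 2 * t by ring] at *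
    have hv : x ^ 2 * t = x ^ 2 + x ^ 3 := by
      rcases sq t with e | e | e | e
      · exact absurd e hv0
      · exact absurd e hva
      · exact absurd e hvb
      · exact e
    rw [hv]
    have none : ∀ w ∈ properZeroDivisors R, w ≠ x ^ 2 + x ^ 3 → (x ^ 2 + x ^ 3) * w = 0 →
        w ≠ x ^ 3 → w ≠ x ^ 2 → False := by
      intro w hw e1 e2 e3 e4
      -- The factor `1 - x` inverts `1 + x` on multiples of `x ^ 2`, since `x ^ 4 = 0`.
      have : x ^ 2 * w = 0 := by linear_combination (1 - x) * e2 + w * h4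
      obtain ⟨t, rfl⟩ := hU.pow_dvd_of_pow_mul_eq_zero this
      rcases sq t with e | e | e | e
      · exact hw.1 e
      · exact e3 e
      · exact e4 e
      · exact e1 e
    exact ⟨Or.inl (by linear_combination (x + x ^ 2) * h4),
      fun w hw e1 e2 e3 e4 => (none w hw e1 e2 e3 e4).elim,
      fun w hw _ _ e1 e2 e3 e4 => (none w hw e1 e2 e3 e4).elim⟩
  · have hu : IsUnit (1 + x * t) := by
      rw [hU.isUnit_iff_not_dvd]
      intro hd
      exact hU.not_isUnit (isUnit_of_dvd_one ((dvd_add_left (dvd_mul_right x t)).1 hd))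
    have none : ∀ w ∈ properZeroDivisors R, x * (1 + x * t) * w = 0 → w ≠ x ^ 3 → False := by
      intro w hw e2 e3
      have : x ^ 1 * w = 0 := by
        rw [← hu.mul_right_eq_zero, ← e2]; ring
      obtain ⟨s, rfl⟩ := hU.pow_dvd_of_pow_mul_eq_zero this
      rcases cube s with e | e
      · exact hw.1 e
      · exact e3 e
    exact ⟨Or.inl (by linear_combination (1 + x * t) * h4),
      fun w hw _ e2 e3 _ => (none w hw e2 e3).elim,
      fun w hw _ _ _ e2 e3 => (none w hw e2 e3).elim⟩

/-- The alliance consists of the nonzero socle elements `x ^ 2` and `-x ^ 2`; every other vertex is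
a unit multiple of `x` and has exactly these two neighbours. -/
theorem hasAllianceTwo_three (h : IsPrimeUniformizer 3 x 2) : HasAllianceTwo R := by
  have h3 : x ^ 3 = 0 := h.pow_eq_zero
  have h2 : x ^ 2 ≠ 0 := h.pow_ne_zero
  have hU := h.isUniformizer
  obtain ⟨c, hc⟩ := h.dvd_prime
  push_cast at hc
  have hneg : x ^ 2 ≠ -x ^ 2 := fun e => h2 (by
    linear_combination -e + x ^ 2 * hc + c * h3)
  have h1 : x ≠ 0 := fun e => h2 (by rw [e]; ring)
  have mem2 : x ^ 2 ∈ properZeroDivisors R :=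
    hU.mem_properZeroDivisors_iff.2 ⟨h2, x, by ring⟩
  have mem2' : -x ^ 2 ∈ properZeroDivisors R :=
    hU.mem_properZeroDivisors_iff.2 ⟨neg_ne_zero.2 h2, -x, by ring⟩
  have sq : ∀ t, x ^ 2 * t = 0 ∨ x ^ 2 * t = x ^ 2 ∨ x ^ 2 * t = -x ^ 2 := by
    intro t
    rcases h.dvd_or_eq_one_add_or t with ⟨s, rfl⟩ | ⟨s, rfl⟩ | ⟨s, rfl⟩
    · left; linear_combination s * h3
    · right; left; linear_combination s * h3
    · right; right; linear_combination s * h3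
  refine ⟨⟨x ^ 2, -x ^ 2, mem2, mem2', hneg, ?_⟩, not_isStarCenter_of_triangle h2
    (neg_ne_zero.2 h2) h1 hneg (fun e => h2 (by linear_combination -x * e + h3))
    (fun e => h2 (by linear_combination -x * e - h3))
    (by linear_combination -x * h3) (by linear_combination h3) (by linear_combination -h3)⟩
  intro v hv hva hvb
  rw [hU.mem_properZeroDivisors_iff] at hv
  obtain ⟨hv0, s, rfl⟩ := hv
  have hs : IsUnit s := by
    refine (hU.isUnit_or_dvd s).resolve_right ?_
    rintro ⟨t, rfl⟩
    rw [show x * (x * t) = x ^ 2 * t by ring] at *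
    rcases sq t with e | e | e
    · exact hv0 e
    · exact hva e
    · exact hvb e
  have none : ∀ w ∈ properZeroDivisors R, x * s * w = 0 → w ≠ x ^ 2 → w ≠ -x ^ 2 → False := by
    intro w hw e2 e3 e4
    have : x ^ 1 * w = 0 := by
      rw [← hs.mul_right_eq_zero, ← e2]; ring
    obtain ⟨t, rfl⟩ := hU.pow_dvd_of_pow_mul_eq_zero this
    rcases sq t with e | e | e
    · exact hw.1 e
    · exact e3 e
    · exact e4 e
  exact ⟨Or.inl (by linear_combination s * h3),
    fun w hw _ e2 e3 e4 => (none w hw e2 e3 e4).elim,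
    fun w hw _ _ _ e2 e3 e4 => (none w hw e2 e3 e4).elim⟩

end IsPrimeUniformizer

/-- The graph is complete on three or four vertices, so any two vertices form an alliance and a
triangle excludes stars. -/
theorem hasAllianceTwo_of_sq_zero [Finite R] {M : Set R} (hM : M.ncard = 4 ∨ M.ncard = 5)
    (h0 : (0 : R) ∈ M) (hmul : ∀ r ∈ M, ∀ s ∈ M, r * s = 0) (hu : ∀ r ∉ M, IsUnit r) :
    HasAllianceTwo R := by
  have hV : ∀ v, v ∈ properZeroDivisors R ↔ v ∈ M \ {0} := by
    intro v
    constructor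
    · rintro ⟨hv, y, hy, e⟩
      refine ⟨?_, hv⟩
      by_contra hvM
      rw [(hu v hvM).mul_right_eq_zero] at e
      exact hy e
    · rintro ⟨hv, hv0⟩
      exact ⟨hv0, v, hv0, hmul v hv v hv⟩
  have hcard := Set.ncard_sdiff_singleton_of_mem h0
  obtain ⟨r, s, t, hr, hs, ht, hrs, hrt, hst⟩ :=
    (Set.two_lt_ncard_iff).1 (show 2 < (M \ {0}).ncard by omega)
  have hmul' : ∀ v ∈ properZeroDivisors R, ∀ w ∈ properZeroDivisors R, v * w = 0 :=
    fun v hv w hw => hmul v ((hV v).1 hv).1 w ((hV w).1 hw).1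
  refine ⟨⟨r, s, (hV r).2 hr, (hV s).2 hs, hrs, fun v hv hvr hvs =>
    ⟨Or.inl (hmul' v hv r ((hV r).2 hr)), fun _ _ _ _ _ _ =>
      ⟨hmul' v hv r ((hV r).2 hr), hmul' v hv s ((hV s).2 hs)⟩, ?_⟩⟩,
    not_isStarCenter_of_triangle hr.2 hs.2 ht.2 hrs hrt hst (hmul r hr.1 s hs.1)
      (hmul r hr.1 t ht.1) (hmul s hs.1 t ht.1)⟩
  intro w hw w' hw' e1 _ e2 e3 f1 _ f2 f3
  by_contra hww
  have h5 : ({r, s, v, w, w'} : Set R).ncard = 5 := by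
    rw [Set.ncard_insert_of_notMem, Set.ncard_insert_of_notMem, Set.ncard_insert_of_notMem,
      Set.ncard_pair hww] <;> simp only [Set.mem_insert_iff, Set.mem_singleton_iff, not_or] <;> tauto
  have hsub : ({r, s, v, w, w'} : Set R) ⊆ M \ {0} := by
    rintro z (rfl | rfl | rfl | rfl | rfl)
    exacts [hr, hs, (hV _).1 hv, (hV _).1 hw, (hV _).1 hw']
  have := Set.ncard_le_ncard hsub
  omega

end Graph

/-- Otherwise `c = a * (d * X) + b * (X ^ k - c)`. Applying `f` to the coefficients gives `b * X ^ k
= 0`, so `b` vanishes under `f`; the constant term then reads `c = -c * b₀`, and `c` annihilates the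
kernel of `f`. -/
theorem X_pow_notMem_span_pair {m p k : ℕ} (hp : 1 < p) (hk : k ≠ 0) (f : ZMod m →+* ZMod p)
    {c d : ZMod m} (hd : f d = 0) (hfc : f c = 0) (h : ∀ a, f a = 0 → c * a = 0) (hc : c ≠ 0)
    {I : Ideal (ZMod m)[X]}
    (hI : I = Ideal.span {Polynomial.C d * Polynomial.X, Polynomial.X ^ k - Polynomial.C c}) :
    (Polynomial.X : (ZMod m)[X]) ^ k ∉ I := by
  intro hmem
  have : Fact (1 < p) := ⟨hp⟩
  have h1 : Polynomial.C c ∈ I := by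
    have h2 : Polynomial.X ^ k - Polynomial.C c ∈ I := by
      rw [hI]; exact Ideal.subset_span (Or.inr rfl)
    simpa using I.sub_mem hmem h2
  rw [hI, Ideal.mem_span_pair] at h1
  obtain ⟨a, b, hab⟩ := h1
  have hb : b.map f = 0 := by
    have := congrArg (Polynomial.map f) hab
    simp only [Polynomial.map_add, Polynomial.map_mul, Polynomial.map_C, hd, Polynomial.map_X,
      Polynomial.map_sub, Polynomial.map_pow, hfc, map_zero, zero_mul, mul_zero, zero_add,
      sub_zero] at this
    ext n
    simpa [Polynomial.coeff_mul_X_pow] using congrArg (Polynomial.coeff · (n + k)) this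
  have hcb : c * b.coeff 0 = 0 := h _ (by rw [← Polynomial.coeff_map, hb, Polynomial.coeff_zero])
  have := congrArg (Polynomial.coeff · 0) hab
  simp only [Polynomial.coeff_add, Polynomial.mul_coeff_zero, Polynomial.coeff_X_zero, mul_zero,
    Polynomial.coeff_sub, Polynomial.coeff_X_pow, hk.symm, if_false, Polynomial.coeff_C_zero,
    zero_add, zero_sub, mul_neg] at this
  exact hc (by rw [← this, mul_comm, hcb, neg_zero])

/-! ### Chain rings of index four with residue field of order two. -/

section CardSixteen

theorem isPrimeUniformizer_two_X_cube_sub_two :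
    IsPrimeUniformizer 2 (Ideal.Quotient.mk (Ideal.span
      {2 * (Polynomial.X : (ZMod 4)[X]), Polynomial.X ^ 3 - 2}) Polynomial.X) 3 := by
  refine isPrimeUniformizer_mk_X Nat.prime_two ?_ ⟨Polynomial.X ^ 2, ?_⟩ ?_
  · exact Ideal.mem_span_pair.2 ⟨1, Polynomial.X, by ring⟩
  · exact Ideal.mem_span_pair.2 ⟨0, -1, by push_cast; ring⟩
  · exact X_pow_notMem_span_pair (p := 2) (c := 2) (d := 2) one_lt_two three_ne_zero
      (ZMod.castHom (by norm_num) _) (by decide) (by decide) (by decide) (by decide)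
      (by rw [map_ofNat])

theorem two_mul_two_zmod_four_polynomial : (2 * 2 : (ZMod 4)[X]) = 0 := by
  rw [← map_ofNat (Polynomial.C : ZMod 4 →+* _), ← map_mul]
  exact (map_eq_zero_iff _ Polynomial.C_injective).2 (by decide)

/-- In both quadratic presentations below `X ^ 3` reduces to `2 * X`, which is nonzero because its
degree is below that of the monic relation. -/
theorem two_mul_X_notMem_span {f : (ZMod 4)[X]} (hf : f.Monic) (hdeg : f.degree = 2) :
    2 * Polynomial.X ∉ Ideal.span {f} := by
  have h2 : (2 : (ZMod 4)[X]) * Polynomial.X = Polynomial.C 2 * Polynomial.X := by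
    rw [map_ofNat]
  rw [Ideal.mem_span_singleton, h2]
  refine hf.not_dvd_of_degree_lt ?_ ?_
  · intro h
    have := congrArg (Polynomial.coeff · 1) h
    simp only [Polynomial.coeff_C_mul, Polynomial.coeff_X_one, Polynomial.coeff_zero] at this
    exact absurd this (by decide)
  · rw [hdeg]
    exact (Polynomial.degree_C_mul_X_le _).trans_lt (by norm_num)

theorem isPrimeUniformizer_two_X_sq_sub_two :
    IsPrimeUniformizer 2 (Ideal.Quotient.mk (Ideal.span
      {(Polynomial.X : (ZMod 4)[X]) ^ 2 - 2}) Polynomial.X) 3 := by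
  have h4 := two_mul_two_zmod_four_polynomial
  refine isPrimeUniformizer_mk_X Nat.prime_two ?_ ⟨Polynomial.X, ?_⟩ fun h => ?_
  · exact Ideal.mem_span_singleton.2 ⟨Polynomial.X ^ 2 + 2, by linear_combination h4⟩
  · exact Ideal.mem_span_singleton.2 ⟨-1, by push_cast; ring⟩
  · have hmon : ((Polynomial.X : (ZMod 4)[X]) ^ 2 - 2).Monic := by monicity!
    refine two_mul_X_notMem_span hmon (by compute_degree!) ?_
    have := Ideal.sub_mem _ h (Ideal.mul_mem_left _ Polynomial.X (Ideal.mem_span_singleton_self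
      ((Polynomial.X : (ZMod 4)[X]) ^ 2 - 2)))
    convert this using 1
    ring

theorem isPrimeUniformizer_two_X_sq_add_two_mul_X_add_two :
    IsPrimeUniformizer 2 (Ideal.Quotient.mk (Ideal.span
      {(Polynomial.X : (ZMod 4)[X]) ^ 2 + 2 * Polynomial.X + 2}) Polynomial.X) 3 := by
  have h4 := two_mul_two_zmod_four_polynomial
  refine isPrimeUniformizer_mk_X Nat.prime_two ?_ ⟨-Polynomial.X - 2, ?_⟩ fun h => ?_
  · exact Ideal.mem_span_singleton.2 ⟨Polynomial.X ^ 2 - 2 * Polynomial.X + 2,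
      by linear_combination -h4⟩
  · exact Ideal.mem_span_singleton.2 ⟨1, by push_cast; ring⟩
  · have hmon : ((Polynomial.X : (ZMod 4)[X]) ^ 2 + 2 * Polynomial.X + 2).Monic := by monicity!
    refine two_mul_X_notMem_span hmon (by compute_degree!) ?_
    have := Ideal.sub_mem _ h (Ideal.mul_mem_left _ (Polynomial.X - 2) (Ideal.mem_span_singleton_self
      ((Polynomial.X : (ZMod 4)[X]) ^ 2 + 2 * Polynomial.X + 2)))
    convert this using 1
    linear_combination -h4

/-- If `8 ≠ 0` or `2 = 0`, the ring is determined at once. Otherwise `2 = w * x ^ i` with `w` a unit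
and `i` equal to `2` or `3`. As `x ^ 4 = 0`, only `w` modulo `x ^ (4 - i)` matters, which leaves `x
^ 2`, `x ^ 2 + x ^ 3` and `x ^ 3`. -/
theorem IsPrimeUniformizer.classification_two {R : Type u} [CommRing R] {x : R}
    (h : IsPrimeUniformizer 2 x 3) :
    Nonempty (R ≃+* ZMod 16) ∨
      Nonempty (R ≃+* (ZMod 2)[X] ⧸ Ideal.span {(Polynomial.X : (ZMod 2)[X]) ^ 4}) ∨
      Nonempty (R ≃+* (ZMod 4)[X] ⧸
        Ideal.span {2 * (Polynomial.X : (ZMod 4)[X]), Polynomial.X ^ 3 - 2}) ∨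
      Nonempty (R ≃+* (ZMod 4)[X] ⧸ Ideal.span {(Polynomial.X : (ZMod 4)[X]) ^ 2 - 2}) ∨
      Nonempty (R ≃+* (ZMod 4)[X] ⧸
        Ideal.span {(Polynomial.X : (ZMod 4)[X]) ^ 2 + 2 * Polynomial.X + 2}) := by
  have h4 : x ^ 4 = 0 := h.pow_eq_zero
  by_cases h8 : ((2 : ℕ) : R) ^ 3 ≠ 0
  · exact Or.inl (h.nonempty_ringEquiv_zmod three_ne_zero h8)
  right
  by_cases h2 : ((2 : ℕ) : R) = 0
  · exact Or.inl (h.nonempty_ringEquiv_quotient_X_pow h2)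
  right
  rw [not_not] at h8
  have key : (2 : R) = x ^ 3 ∨ (2 : R) = x ^ 2 ∨ (2 : R) = x ^ 2 + x ^ 3 := by
    obtain ⟨i, hi, w, hw, e⟩ := h.isUniformizer.exists_eq_unit_mul_pow h2
    push_cast at e h2 h8
    interval_cases i
    · exfalso
      rw [pow_zero, mul_one] at e
      rw [← e] at hw
      have hu := hw.pow 3
      rw [h8, isUnit_zero_iff] at hu
      exact h2 (by rw [← mul_one (2 : R), ← hu, mul_zero])
    · exfalso
      apply h.pow_ne_zero
      rw [e, mul_pow, pow_one] at h8
      exact (hw.pow 3).mul_right_eq_zero.1 h8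
    · right
      rcases h.dvd_or_eq_one_add w with ⟨s, rfl⟩ | ⟨s, rfl⟩
      · exact absurd hw (fun hu => h.isUniformizer.not_isUnit (isUnit_of_mul_isUnit_left hu))
      · rcases h.dvd_or_eq_one_add s with ⟨t, rfl⟩ | ⟨t, rfl⟩
        · left; rw [e]; linear_combination t * h4
        · right; rw [e]; linear_combination t * h4
    · left
      rcases h.dvd_or_eq_one_add w with ⟨s, rfl⟩ | ⟨s, rfl⟩
      · exact absurd hw (fun hu => h.isUniformizer.not_isUnit (isUnit_of_mul_isUnit_left hu))
      · rw [e]; linear_combination s * h4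
  have hfour : ((4 : ℕ) : R) = 0 := by
    have : ((4 : ℕ) : R) = 2 * 2 := by norm_num
    rw [this]
    rcases key with e | e | e <;> rw [e]
    · linear_combination x ^ 2 * h4
    · linear_combination h4
    · linear_combination (1 + x) ^ 2 * h4
  rcases key with e | e | e
  · left
    refine h.nonempty_ringEquiv_quotient hfour
      (Ideal.mem_span_pair.2 ⟨1, Polynomial.X, by ring⟩)
      ⟨Polynomial.X ^ 2, Ideal.mem_span_pair.2 ⟨0, -1, by push_cast; ring⟩⟩
      fun ι => eval₂_eq_zero_of_mem_span ι x ?_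
    rintro g (rfl | rfl)
    · simp only [Polynomial.eval₂_mul, Polynomial.eval₂_X, Polynomial.eval₂_ofNat]
      rw [e]; linear_combination h4
    · simp only [Polynomial.eval₂_sub, Polynomial.eval₂_pow, Polynomial.eval₂_X,
        Polynomial.eval₂_ofNat]
      rw [e]; ring
  · right; left
    have h4' := two_mul_two_zmod_four_polynomial
    refine h.nonempty_ringEquiv_quotient hfour
      (Ideal.mem_span_singleton.2 ⟨Polynomial.X ^ 2 + 2, by linear_combination h4'⟩)
      ⟨Polynomial.X, Ideal.mem_span_singleton.2 ⟨-1, by push_cast; ring⟩⟩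
      fun ι => eval₂_eq_zero_of_mem_span ι x ?_
    rintro g rfl
    simp only [Polynomial.eval₂_sub, Polynomial.eval₂_pow, Polynomial.eval₂_X,
      Polynomial.eval₂_ofNat]
    rw [e]; ring
  · right; right
    have h4' := two_mul_two_zmod_four_polynomial
    refine h.nonempty_ringEquiv_quotient hfour
      (Ideal.mem_span_singleton.2 ⟨Polynomial.X ^ 2 - 2 * Polynomial.X + 2,
        by linear_combination -h4'⟩)
      ⟨-Polynomial.X - 2, Ideal.mem_span_singleton.2 ⟨1, by push_cast; ring⟩⟩
      fun ι => eval₂_eq_zero_of_mem_span ι x ?_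
    rintro g rfl
    simp only [Polynomial.eval₂_add, Polynomial.eval₂_mul, Polynomial.eval₂_pow,
      Polynomial.eval₂_X, Polynomial.eval₂_ofNat]
    push_cast at hfour
    -- Here `2 = x ^ 2 + x ^ 3` gives `2 * x = x ^ 3`, so the relation takes the value `2 + 2 = 0`.
    linear_combination x * e - e + h4 + hfour

end CardSixteen

/-! ### Chain rings of index three with residue field of order three. -/

section CardTwentySeven

theorem nine_zmod_nine_polynomial : (9 : (ZMod 9)[X]) = 0 := by
  rw [← map_ofNat (Polynomial.C : ZMod 9 →+* _)]
  exact (map_eq_zero_iff _ Polynomial.C_injective).2 (by decide)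

theorem isPrimeUniformizer_three_X_sq_sub_three :
    IsPrimeUniformizer 3 (Ideal.Quotient.mk
      (Ideal.span {Polynomial.X ^ 2 - 3, 3 * Polynomial.X} : Ideal (ZMod 9)[X])
        Polynomial.X) 2 := by
  refine isPrimeUniformizer_mk_X Nat.prime_three ?_ ⟨Polynomial.X, ?_⟩ ?_
  · exact Ideal.mem_span_pair.2 ⟨Polynomial.X, 1, by ring⟩
  · exact Ideal.mem_span_pair.2 ⟨-1, 0, by push_cast; ring⟩
  · exact X_pow_notMem_span_pair (p := 3) (c := 3) (d := 3) (by norm_num) two_ne_zero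
      (ZMod.castHom (by norm_num) _) (by decide) (by decide) (by decide) (by decide)
      (by rw [map_ofNat, Set.pair_comm])

theorem isPrimeUniformizer_three_X_sq_sub_six :
    IsPrimeUniformizer 3 (Ideal.Quotient.mk
      (Ideal.span {Polynomial.X ^ 2 - 6, 3 * Polynomial.X} : Ideal (ZMod 9)[X])
        Polynomial.X) 2 := by
  have h9 := nine_zmod_nine_polynomial
  refine isPrimeUniformizer_mk_X Nat.prime_three ?_ ⟨-Polynomial.X, ?_⟩ ?_
  · exact Ideal.mem_span_pair.2 ⟨Polynomial.X, 2, by ring⟩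
  · exact Ideal.mem_span_pair.2 ⟨1, 0, by push_cast; linear_combination -h9⟩
  · exact X_pow_notMem_span_pair (p := 3) (c := 6) (d := 3) (by norm_num) two_ne_zero
      (ZMod.castHom (by norm_num) _) (by decide) (by decide) (by decide) (by decide)
      (by rw [map_ofNat, map_ofNat, Set.pair_comm])

/-- When `9 = 0` and `3 ≠ 0`, the element `3` is a unit times `x ^ 2`. Since `x ^ 3 = 0`, only the
residue `1` or `-1` of that unit matters; the sign `-1` gives `x ^ 2 = -3 = 6`. -/
theorem IsPrimeUniformizer.classification_three {R : Type u} [CommRing R] {x : R}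
    (h : IsPrimeUniformizer 3 x 2) :
    Nonempty (R ≃+* ZMod 27) ∨
      Nonempty (R ≃+* (ZMod 3)[X] ⧸ Ideal.span {(Polynomial.X : (ZMod 3)[X]) ^ 3}) ∨
      Nonempty (R ≃+* (ZMod 9)[X] ⧸
        (Ideal.span {Polynomial.X ^ 2 - 3, 3 * Polynomial.X} : Ideal (ZMod 9)[X])) ∨
      Nonempty (R ≃+* (ZMod 9)[X] ⧸
        (Ideal.span {Polynomial.X ^ 2 - 6, 3 * Polynomial.X} : Ideal (ZMod 9)[X])) := by
  have h3 : x ^ 3 = 0 := h.pow_eq_zero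
  by_cases h9 : ((3 : ℕ) : R) ^ 2 ≠ 0
  · exact Or.inl (h.nonempty_ringEquiv_zmod two_ne_zero h9)
  right
  by_cases h2 : ((3 : ℕ) : R) = 0
  · exact Or.inl (h.nonempty_ringEquiv_quotient_X_pow h2)
  right
  rw [not_not] at h9
  have key : (3 : R) = x ^ 2 ∨ (3 : R) = -x ^ 2 := by
    obtain ⟨t, ht⟩ := h.dvd_prime
    push_cast at ht h2 h9
    have hxt : x ∣ t := by
      refine (h.isUniformizer.isUnit_or_dvd t).resolve_left fun hu => h.pow_ne_zero ?_
      rw [ht, mul_pow] at h9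
      exact (hu.pow 2).mul_left_eq_zero.1 h9
    obtain ⟨s, rfl⟩ := hxt
    rcases h.dvd_or_eq_one_add_or s with ⟨r, rfl⟩ | ⟨r, rfl⟩ | ⟨r, rfl⟩
    · exact absurd (by rw [ht]; linear_combination r * h3) h2
    · left; rw [ht]; linear_combination r * h3
    · right; rw [ht]; linear_combination r * h3
  have hnine : ((9 : ℕ) : R) = 0 := by
    rw [← h9]; norm_num
  rcases key with e | e
  · left
    refine h.nonempty_ringEquiv_quotient hnine
      (Ideal.mem_span_pair.2 ⟨Polynomial.X, 1, by ring⟩)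
      ⟨Polynomial.X, Ideal.mem_span_pair.2 ⟨-1, 0, by push_cast; ring⟩⟩
      fun ι => eval₂_eq_zero_of_mem_span ι x ?_
    rintro g (rfl | rfl)
    · simp only [Polynomial.eval₂_sub, Polynomial.eval₂_pow, Polynomial.eval₂_X,
        Polynomial.eval₂_ofNat]
      rw [e]; ring
    · simp only [Polynomial.eval₂_mul, Polynomial.eval₂_X, Polynomial.eval₂_ofNat]
      rw [e]; linear_combination h3
  · right
    have h9' := nine_zmod_nine_polynomial
    refine h.nonempty_ringEquiv_quotient hnine
      (Ideal.mem_span_pair.2 ⟨Polynomial.X, 2, by ring⟩)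
      ⟨-Polynomial.X, Ideal.mem_span_pair.2 ⟨1, 0, by push_cast; linear_combination -h9'⟩⟩
      fun ι => eval₂_eq_zero_of_mem_span ι x ?_
    push_cast at hnine
    rintro g (rfl | rfl)
    · simp only [Polynomial.eval₂_sub, Polynomial.eval₂_pow, Polynomial.eval₂_X,
        Polynomial.eval₂_ofNat]
      linear_combination e - hnine
    · simp only [Polynomial.eval₂_mul, Polynomial.eval₂_X, Polynomial.eval₂_ofNat]
      rw [e]; linear_combination -h3

end CardTwentySeven

theorem IsPrimeUniformizer.classification_sq {R : Type u} [CommRing R] {p : ℕ} {x : R}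
    (h : IsPrimeUniformizer p x 1) :
    Nonempty (R ≃+* ZMod (p ^ 2)) ∨
      Nonempty (R ≃+* (ZMod p)[X] ⧸ Ideal.span {(Polynomial.X : (ZMod p)[X]) ^ 2}) := by
  by_cases h2 : (p : R) = 0
  · exact Or.inr (h.nonempty_ringEquiv_quotient_X_pow h2)
  · exact Or.inl (h.nonempty_ringEquiv_zmod one_ne_zero (by rwa [pow_one]))

/-- The first isomorphism theorem for multiplication by `v`. When `v` spans part of the socle, the
range has the size of the residue field. -/
theorem card_eq_ncard_annihilator_mul_ncard_range {R : Type u} [CommRing R] (v : R) :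
    Nat.card R = {w | v * w = 0}.ncard * (Set.range (v * ·)).ncard := by
  let f : R →+ R := AddMonoidHom.mulLeft v
  rw [AddSubgroup.card_eq_card_quotient_mul_card_addSubgroup f.ker, mul_comm,
    Nat.card_congr (QuotientAddGroup.quotientKerEquivRange f).toEquiv]
  rfl

theorem IsUniformizer.card_eq_sq {R : Type u} [CommRing R] {x : R} (h : IsUniformizer x 1) :
    Nat.card R = {w | x ∣ w}.ncard ^ 2 := by
  rw [card_eq_ncard_annihilator_mul_ncard_range x, sq]
  congr 2
  · ext w
    constructor
    · intro hw
      simpa using h.pow_dvd_of_pow_mul_eq_zero (i := 1) (w := w) (by simpa using hw)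
    · rintro ⟨s, rfl⟩
      change x * (x * s) = 0
      linear_combination s * h.pow_eq_zero
  · ext w
    exact exists_congr fun s => eq_comm

theorem IsUniformizer.hasAllianceTwo {R : Type u} [CommRing R] [Finite R] {x : R}
    (h : IsUniformizer x 1) (hc : Nat.card R = 16 ∨ Nat.card R = 25) : HasAllianceTwo R := by
  refine hasAllianceTwo_of_sq_zero (M := {w | x ∣ w}) ?_ (dvd_zero x) ?_ ?_
  · rw [h.card_eq_sq] at hc
    refine hc.imp (fun e => ?_) (fun e => ?_)
    · exact Nat.pow_left_injective two_ne_zero (e.trans (by norm_num : 16 = 4 ^ 2))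
    · exact Nat.pow_left_injective two_ne_zero (e.trans (by norm_num : 25 = 5 ^ 2))
  · rintro _ ⟨s, rfl⟩ _ ⟨t, rfl⟩
    linear_combination s * t * h.pow_eq_zero
  · exact fun r hr => (h.isUnit_or_dvd r).resolve_right hr

theorem natCard_quotient_span_monic {A : Type u} [CommRing A] [Nontrivial A] {f : A[X]}
    (hf : f.Monic) : Nat.card (A[X] ⧸ Ideal.span {f}) = Nat.card A ^ f.natDegree := by
  have e := (AdjoinRoot.powerBasis' hf).basis.equivFun
  have := Nat.card_congr e.toEquiv
  rw [Nat.card_fun] at this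
  change Nat.card (AdjoinRoot f) = _
  simpa using this

/-! ### Principal maximal ideal of square zero, residue field of order four. -/

section FieldOfFour

theorem isUniformizer_quotient_X_sq (K : Type u) [Field K] :
    IsUniformizer (Ideal.Quotient.mk (Ideal.span {(Polynomial.X : K[X]) ^ 2}) Polynomial.X) 1 := by
  have h2 : (Ideal.Quotient.mk (Ideal.span {(Polynomial.X : K[X]) ^ 2}) Polynomial.X) ^ 2 = 0 := by
    rw [← map_pow]; exact Ideal.Quotient.eq_zero_iff_mem.2 (Ideal.subset_span rfl)
  refine ⟨h2, fun h => ?_, fun r => ?_⟩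
  · rw [pow_one, Ideal.Quotient.eq_zero_iff_mem, Ideal.mem_span_singleton] at h
    exact (Polynomial.monic_X_pow 2).not_dvd_of_degree_lt Polynomial.X_ne_zero
      (by rw [Polynomial.degree_X_pow, Polynomial.degree_X]; norm_num) h
  · obtain ⟨f, rfl⟩ := Ideal.Quotient.mk_surjective r
    rw [← f.divX_mul_X_add, map_add, map_mul]
    by_cases hc : f.coeff 0 = 0
    · right; rw [hc, map_zero, map_zero, add_zero]; exact dvd_mul_left _ _
    · left
      refine IsNilpotent.isUnit_add_right_of_commute ⟨2, ?_⟩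
        (((isUnit_iff_ne_zero.2 hc).map Polynomial.C).map _) (Commute.all _ _)
      rw [mul_pow, h2, mul_zero]

theorem monic_X_sq_add_X_add_one : ((Polynomial.X : (ZMod 4)[X]) ^ 2 + Polynomial.X + 1).Monic := by
  monicity!

theorem natDegree_X_sq_add_X_add_one :
    ((Polynomial.X : (ZMod 4)[X]) ^ 2 + Polynomial.X + 1).natDegree = 2 := by
  compute_degree!

theorem isUniformizer_quotient_X_sq_add_X_add_one :
    IsUniformizer (2 : (ZMod 4)[X] ⧸
      Ideal.span {(Polynomial.X : (ZMod 4)[X]) ^ 2 + Polynomial.X + 1}) 1 := by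
  have : Fact (1 < 4) := ⟨by norm_num⟩
  have hmon := monic_X_sq_add_X_add_one
  have hnat := natDegree_X_sq_add_X_add_one
  have hX := Ideal.Quotient.eq_zero_iff_mem.2
    (Ideal.mem_span_singleton_self ((Polynomial.X : (ZMod 4)[X]) ^ 2 + Polynomial.X + 1))
  rw [map_add, map_add, map_pow, map_one] at hX
  refine ⟨?_, fun h => ?_, fun r => ?_⟩
  · have := congrArg (Ideal.Quotient.mk (Ideal.span
      {(Polynomial.X : (ZMod 4)[X]) ^ 2 + Polynomial.X + 1})) two_mul_two_zmod_four_polynomial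
    rw [map_mul, map_ofNat, map_zero] at this
    exact (sq _).trans this
  · rw [pow_one, ← map_ofNat (Ideal.Quotient.mk _), Ideal.Quotient.eq_zero_iff_mem,
      Ideal.mem_span_singleton] at h
    have h2 : (Polynomial.C 2 : (ZMod 4)[X]) ≠ 0 := by
      rw [Ne, Polynomial.C_eq_zero]; decide
    refine hmon.not_dvd_of_degree_lt h2 ?_ h
    rw [Polynomial.degree_eq_natDegree hmon.ne_zero, hnat]
    exact Polynomial.degree_C_le.trans_lt (by norm_num)
  · obtain ⟨f, rfl⟩ := Ideal.Quotient.mk_surjective r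
    obtain ⟨c, d, hcd⟩ := Polynomial.exists_eq_X_add_C_of_natDegree_le_one
      (p := f %ₘ (Polynomial.X ^ 2 + Polynomial.X + 1))
      (Nat.lt_succ_iff.1 ((Polynomial.natDegree_modByMonic_lt f hmon (by
        intro e; rw [e, Polynomial.natDegree_one] at hnat; omega)).trans_eq hnat))
    have hf : Ideal.Quotient.mk (Ideal.span {Polynomial.X ^ 2 + Polynomial.X + 1}) f =
        Ideal.Quotient.mk _ (Polynomial.C c) * Ideal.Quotient.mk _ Polynomial.X +
          Ideal.Quotient.mk _ (Polynomial.C d) := by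
      rw [← map_mul, ← map_add, ← hcd, Ideal.Quotient.mk_eq_mk_iff_sub_mem,
        Polynomial.modByMonic_eq_sub_mul_div, sub_sub_cancel]
      exact Ideal.mul_mem_right _ _ (Ideal.mem_span_singleton_self _)
    rw [hf]
    -- The form is the norm of `c * X + d` modulo `X ^ 2 + X + 1`. If it is a unit, the conjugate `d
    -- - c - c * X` gives the inverse; otherwise both coefficients are even.
    have key : ∀ c d : ZMod 4, (∃ i, (c ^ 2 - c * d + d ^ 2) * i = 1) ∨
        ∃ c' d', c = 2 * c' ∧ d = 2 * d' := by decide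
    rcases key c d with ⟨i, hi⟩ | ⟨c', d', rfl, rfl⟩
    · left
      have hi' := congrArg (fun t => Ideal.Quotient.mk (Ideal.span
        {(Polynomial.X : (ZMod 4)[X]) ^ 2 + Polynomial.X + 1}) (Polynomial.C t)) hi
      simp only [map_mul, map_add, map_sub, map_pow, map_one] at hi'
      refine IsUnit.of_mul_eq_one ((Ideal.Quotient.mk _ (Polynomial.C d) -
        Ideal.Quotient.mk _ (Polynomial.C c) - Ideal.Quotient.mk _ (Polynomial.C c) *
          Ideal.Quotient.mk _ Polynomial.X) * Ideal.Quotient.mk _ (Polynomial.C i)) ?_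
      linear_combination hi' - (Ideal.Quotient.mk _ (Polynomial.C c)) ^ 2 *
        Ideal.Quotient.mk _ (Polynomial.C i) * hX
    · right
      refine ⟨Ideal.Quotient.mk _ (Polynomial.C c') * Ideal.Quotient.mk _ Polynomial.X +
        Ideal.Quotient.mk _ (Polynomial.C d'), ?_⟩
      simp only [map_mul, map_ofNat]
      ring

theorem natCard_quotient_galoisField_X_sq : Nat.card ((GaloisField 2 2)[X] ⧸
    Ideal.span {(Polynomial.X : (GaloisField 2 2)[X]) ^ 2}) = 16 := by
  rw [natCard_quotient_span_monic (Polynomial.monic_X_pow 2), GaloisField.card 2 2 two_ne_zero,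
    Polynomial.natDegree_X_pow]
  norm_num

theorem natCard_quotient_X_sq_add_X_add_one : Nat.card ((ZMod 4)[X] ⧸
    Ideal.span {(Polynomial.X : (ZMod 4)[X]) ^ 2 + Polynomial.X + 1}) = 16 := by
  have : Fact (1 < 4) := ⟨by norm_num⟩
  rw [natCard_quotient_span_monic monic_X_sq_add_X_add_one, natDegree_X_sq_add_X_add_one,
    Nat.card_zmod]
  norm_num

theorem IsUniformizer.isMaximal {R : Type u} [CommRing R] {x : R} {n : ℕ}
    (h : IsUniformizer x n) : (Ideal.span {x}).IsMaximal := by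
  rw [Ideal.isMaximal_iff]
  constructor
  · rw [Ideal.mem_span_singleton]
    exact fun hd => h.not_isUnit (isUnit_of_dvd_one hd)
  · intro J r _ hr hrJ
    rw [Ideal.mem_span_singleton, ← h.isUnit_iff_not_dvd] at hr
    rw [← Ideal.eq_top_iff_one]
    exact J.eq_top_of_isUnit_mem hrJ hr

/-- The residue field of order four is lifted: as a subfield if `2 = 0`, and otherwise through a
root of `X ^ 2 + X + 1`. Injectivity and equal cardinalities then give the isomorphism. -/
theorem IsUniformizer.classification_sixteen {R : Type u} [CommRing R] [Finite R] {x : R}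
    (h : IsUniformizer x 1) (hc : Nat.card R = 16) :
    Nonempty (R ≃+* (GaloisField 2 2)[X] ⧸
        Ideal.span {(Polynomial.X : (GaloisField 2 2)[X]) ^ 2}) ∨
      Nonempty (R ≃+* (ZMod 4)[X] ⧸
        Ideal.span {(Polynomial.X : (ZMod 4)[X]) ^ 2 + Polynomial.X + 1}) := by
  classical
  have hfin : Finite (R ⧸ Ideal.span {x}) :=
    Finite.of_surjective _ Ideal.Quotient.mk_surjective
  have hmax := h.isMaximal
  have hx2 : x ^ 2 = 0 := h.pow_eq_zero
  have hx1 : x ≠ 0 := by simpa using h.pow_ne_zero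
  let : Field (R ⧸ Ideal.span {x}) := Ideal.Quotient.field _
  let : Fintype (R ⧸ Ideal.span {x}) := Fintype.ofFinite _
  have hk : Nat.card (R ⧸ Ideal.span {x}) = 4 := by
    have h1 := h.card_eq_sq
    have h2 : {w | x ∣ w}.ncard = 4 :=
      Nat.pow_left_injective two_ne_zero ((h1.symm.trans hc).trans (by norm_num : 16 = 4 ^ 2))
    have h3 := Submodule.card_eq_card_quotient_mul_card (Ideal.span {x})
    have h4 : Nat.card (Ideal.span {x}) = {w | x ∣ w}.ncard := by
      change Nat.card ((Ideal.span {x} : Ideal R) : Set R) = _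
      rw [Nat.card_coe_set_eq]
      congr 1
      ext w
      exact Ideal.mem_span_singleton
    rw [h4, h2, hc] at h3
    omega
  rw [Nat.card_eq_fintype_card] at hk
  have h2k : (2 : R ⧸ Ideal.span {x}) = 0 := by
    have := Nat.cast_card_eq_zero (R ⧸ Ideal.span {x})
    rw [hk] at this
    have h22 : (2 : R ⧸ Ideal.span {x}) * 2 = 0 := by rw [← this]; norm_num
    simpa using h22
  have h2R : x ∣ 2 := by
    rw [← Ideal.mem_span_singleton, ← Ideal.Quotient.eq_zero_iff_mem, map_ofNat]
    exact h2k
  by_cases h2 : (2 : R) = 0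
  · left
    have : Nontrivial R := ⟨x, 0, hx1⟩
    have : CharP R 2 := CharTwo.of_one_ne_zero_of_two_eq_zero one_ne_zero h2
    let : Fintype (GaloisField 2 2) := Fintype.ofFinite _
    let e : GaloisField 2 2 ≃+* R ⧸ Ideal.span {x} := FiniteField.ringEquivOfCardEq (by
      rw [hk, ← Nat.card_eq_fintype_card, GaloisField.card 2 2 two_ne_zero]; norm_num)
    -- In characteristic two `r ↦ r ^ 4` is a ring homomorphism, and it kills the multiples of `x`.
    let σ : R ⧸ Ideal.span {x} →+* R := Ideal.Quotient.lift _ (iterateFrobenius R 2 2) (by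
      intro r hr
      obtain ⟨s, rfl⟩ := Ideal.mem_span_singleton.1 hr
      rw [iterateFrobenius_def]
      linear_combination s ^ 4 * x ^ 2 * hx2)
    let f : (GaloisField 2 2)[X] ⧸ Ideal.span {(Polynomial.X : (GaloisField 2 2)[X]) ^ 2} →+* R :=
      Ideal.Quotient.lift _ (Polynomial.eval₂RingHom (σ.comp e.toRingHom) x)
        (eval₂_eq_zero_of_mem_span _ x (by
          rintro g rfl
          rw [Polynomial.eval₂_pow, Polynomial.eval₂_X, hx2]))
    have hf : f (Ideal.Quotient.mk _ Polynomial.X) = x :=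
      (Ideal.Quotient.lift_mk _ _ _).trans (Polynomial.eval₂_X _ x)
    have hinj := (isUniformizer_quotient_X_sq (GaloisField 2 2)).injective f
      (by rw [hf]; exact h.pow_ne_zero)
    exact ⟨(RingEquiv.ofBijective f (hinj.bijective_of_nat_card_le
      (by rw [hc, natCard_quotient_galoisField_X_sq]))).symm⟩
  · right
    have h4 : ((4 : ℕ) : R) = 0 := by
      obtain ⟨s, hs⟩ := h2R
      have : ((4 : ℕ) : R) = 2 * 2 := by norm_num
      rw [this, hs]
      linear_combination s ^ 2 * hx2
    obtain ⟨w, hw⟩ : ∃ w : R ⧸ Ideal.span {x}, w ∉ ({0, 1} : Finset _) := by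
      by_contra! hall
      have : Fintype.card (R ⧸ Ideal.span {x}) ≤ 2 := by
        rw [← Finset.card_univ]
        exact (Finset.card_le_card (fun w _ => hall w)).trans Finset.card_le_two
      omega
    simp only [Finset.mem_insert, Finset.mem_singleton, not_or] at hw
    have hw3 : w ^ 2 + w + 1 = 0 := by
      have h3 := FiniteField.pow_card_sub_one_eq_one w hw.1
      rw [hk] at h3
      have : (w - 1) * (w ^ 2 + w + 1) = 0 := by linear_combination h3
      exact (mul_eq_zero.1 this).resolve_left (sub_ne_zero.2 hw.2)
    obtain ⟨a, rfl⟩ := Ideal.Quotient.mk_surjective w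
    have ht : x ∣ a ^ 2 + a + 1 := by
      rw [← Ideal.mem_span_singleton, ← Ideal.Quotient.eq_zero_iff_mem, ← hw3]
      simp
    obtain ⟨t, ht⟩ := ht
    obtain ⟨s, hs⟩ := h2R
    obtain ⟨ι⟩ := ZMod.exists_ringHom h4
    -- One Newton step makes the root exact: with `a ^ 2 + a + 1 = x * t`, the derivative `2 * a +
    -- 1` is `1` modulo `x`, so the correction is `-x * t`.
    let f : (ZMod 4)[X] ⧸
        Ideal.span {(Polynomial.X : (ZMod 4)[X]) ^ 2 + Polynomial.X + 1} →+* R :=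
      Ideal.Quotient.lift _ (Polynomial.eval₂RingHom ι (a - x * t))
        (eval₂_eq_zero_of_mem_span _ _ (by
          rintro g rfl
          simp only [Polynomial.eval₂_add, Polynomial.eval₂_pow, Polynomial.eval₂_X,
            Polynomial.eval₂_one]
          linear_combination ht + (t ^ 2 - s * a * t) * hx2 - a * x * t * hs))
    have hinj := isUniformizer_quotient_X_sq_add_X_add_one.injective f
      (by rw [pow_one, map_ofNat]; exact h2)
    exact ⟨(RingEquiv.ofBijective f (hinj.bijective_of_nat_card_le
      (by rw [hc, natCard_quotient_X_sq_add_X_add_one]))).symm⟩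

end FieldOfFour

/-! ### Non-principal maximal ideal of square zero, residue field of order two. -/

/-- `{0, x, y, x + y}` is an ideal with four elements, square zero and residue ring `ℤ/2`. -/
structure IsSqZeroBasis {R : Type*} [CommRing R] (x y : R) : Prop where
  left_sq : x * x = 0
  mul : x * y = 0
  right_sq : y * y = 0
  left_add : x + x = 0
  right_add : y + y = 0
  left_ne_zero : x ≠ 0
  right_ne_zero : y ≠ 0
  ne : x ≠ y
  mem_or_sub_one_mem : ∀ r : R, r ∈ ({0, x, y, x + y} : Set R) ∨ r - 1 ∈ ({0, x, y, x + y} : Set R)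

namespace IsSqZeroBasis

variable {R : Type u} [CommRing R] {x y : R}

theorem add_ne_zero (h : IsSqZeroBasis x y) : x + y ≠ 0 :=
  fun e => h.ne (by linear_combination e - h.right_add)

theorem mul_eq_zero (h : IsSqZeroBasis x y) {r s : R} (hr : r ∈ ({0, x, y, x + y} : Set R))
    (hs : s ∈ ({0, x, y, x + y} : Set R)) : r * s = 0 := by
  have h1 := h.left_sq
  have h2 := h.mul
  have h3 := h.right_sq
  rcases hr with rfl | rfl | rfl | rfl <;> rcases hs with rfl | rfl | rfl | rfl <;> grind

theorem hasAllianceTwo [Finite R] (h : IsSqZeroBasis x y) : HasAllianceTwo R := by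
  refine hasAllianceTwo_of_sq_zero (M := {0, x, y, x + y}) (Or.inl ?_) (Or.inl rfl)
    (fun r hr s hs => h.mul_eq_zero hr hs) ?_
  · have h1 := h.left_ne_zero
    have h2 := h.right_ne_zero
    have h3 := h.ne
    have h4 := h.add_ne_zero
    have h5 : x ≠ x + y := by simpa using h2
    have h6 : y ≠ x + y := by simpa using h1
    rw [Set.ncard_insert_of_notMem, Set.ncard_insert_of_notMem, Set.ncard_pair h6] <;>
      simp only [Set.mem_insert_iff, Set.mem_singleton_iff, not_or] <;> tauto
  · intro r hr
    have hs := (h.mem_or_sub_one_mem r).resolve_left hr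
    have : IsNilpotent (r - 1) := ⟨2, by rw [sq]; exact h.mul_eq_zero hs hs⟩
    simpa using this.isUnit_add_one

end IsSqZeroBasis

theorem RingHom.map_eq_zero_of_mem_span_pair_sq {A : Type u} {R : Type v} [CommRing A] [CommRing R]
    (f : A →+* R) {p q : A} (hp : f p * f p = 0) (hpq : f p * f q = 0) (hq : f q * f q = 0) :
    ∀ a ∈ Ideal.span {p, q} ^ 2, f a = 0 := by
  have : Ideal.span {p, q} ^ 2 ≤ RingHom.ker f := by
    rw [sq, Ideal.mul_le]
    intro r hr s hs
    obtain ⟨a, b, rfl⟩ := Ideal.mem_span_pair.1 hr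
    obtain ⟨c, d, rfl⟩ := Ideal.mem_span_pair.1 hs
    rw [RingHom.mem_ker]
    simp only [map_mul, map_add]
    linear_combination f a * f c * hp + (f a * f d + f b * f c) * hpq + f b * f d * hq
  exact fun a ha => this ha

section MvPolynomialTwo

theorem exists_sub_linear_mem_span_X_sq (f : MvPolynomial (Fin 2) (ZMod 2)) :
    ∃ a b c, f - (MvPolynomial.C a + MvPolynomial.C b * MvPolynomial.X 0 +
      MvPolynomial.C c * MvPolynomial.X 1) ∈ (Ideal.span
        {(MvPolynomial.X 0 : MvPolynomial (Fin 2) (ZMod 2)), MvPolynomial.X 1}) ^ 2 := by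
  have m0 : (MvPolynomial.X 0 : MvPolynomial (Fin 2) (ZMod 2)) ∈ Ideal.span
      {(MvPolynomial.X 0 : MvPolynomial (Fin 2) (ZMod 2)), MvPolynomial.X 1} :=
    Ideal.subset_span (Or.inl rfl)
  have m1 : (MvPolynomial.X 1 : MvPolynomial (Fin 2) (ZMod 2)) ∈ Ideal.span
      {(MvPolynomial.X 0 : MvPolynomial (Fin 2) (ZMod 2)), MvPolynomial.X 1} :=
    Ideal.subset_span (Or.inr rfl)
  have m00 := Ideal.mul_mem_mul m0 m0
  have m01 := Ideal.mul_mem_mul m0 m1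
  have m11 := Ideal.mul_mem_mul m1 m1
  rw [← sq] at m00 m01 m11
  induction f using MvPolynomial.induction_on with
  | C a => exact ⟨a, 0, 0, by simp⟩
  | add p q hp hq =>
    obtain ⟨a, b, c, hp⟩ := hp
    obtain ⟨a', b', c', hq⟩ := hq
    refine ⟨a + a', b + b', c + c', ?_⟩
    convert Ideal.add_mem _ hp hq using 1
    simp only [map_add]
    ring
  | mul_X p i hp =>
    obtain ⟨a, b, c, hp⟩ := hp
    have hi : i = 0 ∨ i = 1 := by omega
    rcases hi with rfl | rfl
    · refine ⟨0, a, 0, ?_⟩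
      convert Ideal.add_mem _ (Ideal.mul_mem_right (MvPolynomial.X 0) _ hp)
        (Ideal.add_mem _ (Ideal.mul_mem_left _ (MvPolynomial.C b) m00)
          (Ideal.mul_mem_left _ (MvPolynomial.C c) m01)) using 1
      simp only [map_zero]
      ring
    · refine ⟨0, 0, a, ?_⟩
      convert Ideal.add_mem _ (Ideal.mul_mem_right (MvPolynomial.X 1) _ hp)
        (Ideal.add_mem _ (Ideal.mul_mem_left _ (MvPolynomial.C b) m01)
          (Ideal.mul_mem_left _ (MvPolynomial.C c) m11)) using 1
      simp only [map_zero]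
      ring

theorem IsSqZeroBasis.nonempty_ringEquiv_mvPolynomial {R : Type u} [CommRing R] {x y : R}
    (h : IsSqZeroBasis x y) (h2 : (2 : R) = 0) :
    Nonempty (R ≃+* MvPolynomial (Fin 2) (ZMod 2) ⧸
        (Ideal.span {(MvPolynomial.X 0 : MvPolynomial (Fin 2) (ZMod 2)), MvPolynomial.X 1}) ^ 2) := by
  obtain ⟨ι⟩ := ZMod.exists_ringHom (R := R) (m := 2) (by exact_mod_cast h2)
  let g : MvPolynomial (Fin 2) (ZMod 2) →+* R := MvPolynomial.eval₂Hom ι ![x, y]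
  have g0 : g (MvPolynomial.X 0) = x := by simp [g]
  have g1 : g (MvPolynomial.X 1) = y := by simp [g]
  have gC : ∀ c, g (MvPolynomial.C c) = ι c := fun c => by simp [g]
  let f := Ideal.Quotient.lift _ g (g.map_eq_zero_of_mem_span_pair_sq
    (p := MvPolynomial.X 0) (q := MvPolynomial.X 1) (by rw [g0]; exact h.left_sq) (by rw [g0, g1]; exact h.mul) (by rw [g1]; exact h.right_sq))
  refine ⟨(RingEquiv.ofBijective f ⟨?_, ?_⟩).symm⟩
  · rw [injective_iff_map_eq_zero]
    intro r hr
    obtain ⟨p, rfl⟩ := Ideal.Quotient.mk_surjective r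
    obtain ⟨a, b, c, hp⟩ := exists_sub_linear_mem_span_X_sq p
    rw [← Ideal.Quotient.mk_eq_mk_iff_sub_mem] at hp
    rw [hp] at hr ⊢
    have hr : ι a + ι b * x + ι c * y = 0 := by
      rw [← hr, Ideal.Quotient.lift_mk]
      simp only [map_add, map_mul, g0, g1, gC]
    have two : ∀ c : ZMod 2, c = 0 ∨ c = 1 := by decide
    have ha : a = 0 := by
      refine (two a).resolve_right ?_
      rintro rfl
      rw [map_one] at hr
      -- Multiplication by `x` removes the linear terms and isolates the constant coefficient.
      exact h.left_ne_zero (by linear_combination x * hr - ι b * h.left_sq - ι c * h.mul)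
    subst ha
    rcases two b with rfl | rfl <;> rcases two c with rfl | rfl <;>
      simp only [map_zero, map_one, zero_mul, one_mul, zero_add, add_zero] at hr ⊢
    · exact absurd hr h.right_ne_zero
    · exact absurd hr h.left_ne_zero
    · exact absurd hr h.add_ne_zero
  · have hx : x ∈ f.range := ⟨Ideal.Quotient.mk _ (MvPolynomial.X 0), g0⟩
    have hy : y ∈ f.range := ⟨Ideal.Quotient.mk _ (MvPolynomial.X 1), g1⟩
    have hM : ∀ r ∈ ({0, x, y, x + y} : Set R), r ∈ f.range := by
      rintro r (rfl | rfl | rfl | rfl)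
      exacts [zero_mem _, hx, hy, add_mem hx hy]
    intro r
    rcases h.mem_or_sub_one_mem r with hr | hr
    · exact hM r hr
    · have := add_mem (hM _ hr) (one_mem _)
      rwa [sub_add_cancel] at this

theorem isSqZeroBasis_mvPolynomial : IsSqZeroBasis
    (Ideal.Quotient.mk ((Ideal.span
      {(MvPolynomial.X 0 : MvPolynomial (Fin 2) (ZMod 2)), MvPolynomial.X 1}) ^ 2)
        (MvPolynomial.X 0))
    (Ideal.Quotient.mk _ (MvPolynomial.X 1)) := by
  have m0 : (MvPolynomial.X 0 : MvPolynomial (Fin 2) (ZMod 2)) ∈ Ideal.span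
      {(MvPolynomial.X 0 : MvPolynomial (Fin 2) (ZMod 2)), MvPolynomial.X 1} :=
    Ideal.subset_span (Or.inl rfl)
  have m1 : (MvPolynomial.X 1 : MvPolynomial (Fin 2) (ZMod 2)) ∈ Ideal.span
      {(MvPolynomial.X 0 : MvPolynomial (Fin 2) (ZMod 2)), MvPolynomial.X 1} :=
    Ideal.subset_span (Or.inr rfl)
  have m00 := Ideal.mul_mem_mul m0 m0
  have m01 := Ideal.mul_mem_mul m0 m1
  have m11 := Ideal.mul_mem_mul m1 m1
  rw [← sq, ← Ideal.Quotient.eq_zero_iff_mem, map_mul] at m00 m01 m11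
  -- Homomorphisms to the dual numbers witness nonvanishing: sending one variable to `ε` and the
  -- other to `0` kills the squared ideal but neither that variable nor the difference of the two.
  have key : ∀ u v : DualNumber (ZMod 2), u * u = 0 → u * v = 0 → v * v = 0 →
      ∀ f ∈ (Ideal.span {(MvPolynomial.X 0 : MvPolynomial (Fin 2) (ZMod 2)),
        MvPolynomial.X 1}) ^ 2, MvPolynomial.eval₂Hom (algebraMap _ _) ![u, v] f = 0 := by
    intro u v h1 h2 h3
    exact RingHom.map_eq_zero_of_mem_span_pair_sq _ (by simpa using h1) (by simpa using h2)
      (by simpa using h3)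
  have hε : (DualNumber.eps : DualNumber (ZMod 2)) ≠ 0 := fun e => by
    simpa using congrArg TrivSqZeroExt.snd e
  have hadd : ∀ r : MvPolynomial (Fin 2) (ZMod 2), r + r = 0 := CharTwo.add_self_eq_zero
  refine ⟨m00, m01, m11, ?_, ?_, fun e => ?_, fun e => ?_, fun e => ?_, fun r => ?_⟩
  · rw [← map_add, hadd, map_zero]
  · rw [← map_add, hadd, map_zero]
  · rw [Ideal.Quotient.eq_zero_iff_mem] at e
    exact hε (by simpa using key DualNumber.eps 0 (by simp) (by simp) (by simp) _ e)
  · rw [Ideal.Quotient.eq_zero_iff_mem] at e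
    exact hε (by simpa using key 0 DualNumber.eps (by simp) (by simp) (by simp) _ e)
  · rw [Ideal.Quotient.mk_eq_mk_iff_sub_mem] at e
    exact hε (by simpa using key DualNumber.eps 0 (by simp) (by simp) (by simp) _ e)
  · obtain ⟨p, rfl⟩ := Ideal.Quotient.mk_surjective r
    obtain ⟨a, b, c, hp⟩ := exists_sub_linear_mem_span_X_sq p
    rw [← Ideal.Quotient.mk_eq_mk_iff_sub_mem] at hp
    rw [hp]
    have two : ∀ c : ZMod 2, c = 0 ∨ c = 1 := by decide
    have hM : ∀ b c : ZMod 2, Ideal.Quotient.mk ((Ideal.span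
        {(MvPolynomial.X 0 : MvPolynomial (Fin 2) (ZMod 2)), MvPolynomial.X 1}) ^ 2)
        (MvPolynomial.C b * MvPolynomial.X 0 + MvPolynomial.C c * MvPolynomial.X 1) ∈
        ({0, Ideal.Quotient.mk _ (MvPolynomial.X 0), Ideal.Quotient.mk _ (MvPolynomial.X 1),
          Ideal.Quotient.mk _ (MvPolynomial.X 0) + Ideal.Quotient.mk _ (MvPolynomial.X 1)} :
          Set _) := by
      intro b c
      rcases two b with rfl | rfl <;> rcases two c with rfl | rfl <;> simp
    rcases two a with rfl | rfl
    · left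
      simpa only [map_zero, zero_add] using hM b c
    · right
      convert hM b c using 1
      simp only [map_add, map_one]
      ring

end MvPolynomialTwo

section ZModFour

theorem IsSqZeroBasis.nonempty_ringEquiv_zmod_four {R : Type u} [CommRing R] {y : R}
    (h : IsSqZeroBasis 2 y) :
    Nonempty (R ≃+* (ZMod 4)[X] ⧸ (Ideal.span {(2 : (ZMod 4)[X]), Polynomial.X}) ^ 2) := by
  obtain ⟨ι⟩ := ZMod.exists_ringHom (R := R) (m := 4) (by
    push_cast; linear_combination h.left_sq)
  let g : (ZMod 4)[X] →+* R := Polynomial.eval₂RingHom ι y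
  have g2 : g 2 = 2 := map_ofNat g 2
  have gX : g Polynomial.X = y := Polynomial.eval₂_X ι y
  have gC : ∀ c, g (Polynomial.C c) = ι c := fun c => Polynomial.eval₂_C ι y
  let f := Ideal.Quotient.lift _ g (g.map_eq_zero_of_mem_span_pair_sq
    (p := 2) (q := Polynomial.X) (by rw [g2]; exact h.left_sq) (by rw [g2, gX]; exact h.mul)
    (by rw [gX]; exact h.right_sq))
  refine ⟨(RingEquiv.ofBijective f ⟨?_, ?_⟩).symm⟩
  · rw [injective_iff_map_eq_zero]
    intro r hr
    obtain ⟨p, rfl⟩ := Ideal.Quotient.mk_surjective r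
    rw [Ideal.Quotient.lift_mk] at hr
    have m2 : (2 : (ZMod 4)[X]) ∈ Ideal.span {(2 : (ZMod 4)[X]), Polynomial.X} :=
      Ideal.subset_span (Or.inl rfl)
    have mX : Polynomial.X ∈ Ideal.span {(2 : (ZMod 4)[X]), Polynomial.X} :=
      Ideal.subset_span (Or.inr rfl)
    have m2X := Ideal.mul_mem_mul m2 mX
    have mXX := Ideal.mul_mem_mul mX mX
    rw [← sq] at m2X mXX
    obtain ⟨a, b, q, rfl⟩ : ∃ a b q, p = Polynomial.C a + Polynomial.C b * Polynomial.X +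
        q * (Polynomial.X * Polynomial.X) := by
      refine ⟨p.coeff 0, p.divX.coeff 0, p.divX.divX, ?_⟩
      conv_lhs => rw [← p.divX_mul_X_add, ← p.divX.divX_mul_X_add]
      ring
    simp only [map_add, map_mul, gX, gC] at hr
    -- Parities are settled in turn: odd `a` gives `y = 0` after multiplication by `y`; odd `b`
    -- gives `y = 0` or `2 + y = 0`; and with both even, odd `a / 2` gives `2 = 0`.
    have two : ∀ b : ZMod 4, (∃ d, b = 2 * d) ∨ ∃ d, b = 1 + 2 * d := by decide
    have ha : ∃ d, a = 2 * d := by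
      refine (two a).resolve_right ?_
      rintro ⟨d, rfl⟩
      rw [map_add, map_mul, map_one, map_ofNat] at hr
      exact h.right_ne_zero (by
        linear_combination y * hr - ι d * h.mul - (ι b + g q * y) * h.right_sq)
    obtain ⟨d, rfl⟩ := ha
    have hb : ∃ d, b = 2 * d := by
      refine (two b).resolve_right ?_
      rintro ⟨c, rfl⟩
      simp only [map_add, map_mul, map_one, map_ofNat] at hr
      rcases two d with ⟨e, rfl⟩ | ⟨e, rfl⟩
      · simp only [map_mul, map_ofNat] at hr
        exact h.right_ne_zero (by
          linear_combination hr - ι e * h.left_sq - ι c * h.mul - g q * h.right_sq)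
      · simp only [map_add, map_mul, map_one, map_ofNat] at hr
        exact h.add_ne_zero (by
          linear_combination hr - ι e * h.left_sq - ι c * h.mul - g q * h.right_sq)
    obtain ⟨c, rfl⟩ := hb
    have hd : (2 * d : ZMod 4) = 0 := by
      rcases two d with ⟨e, rfl⟩ | ⟨e, rfl⟩
      · exact (by decide : ∀ e : ZMod 4, 2 * (2 * e) = 0) e
      · exfalso
        simp only [map_add, map_mul, map_one, map_ofNat] at hr
        exact h.left_ne_zero (by
          linear_combination hr - ι e * h.left_sq - ι c * h.mul - g q * h.right_sq)
    rw [hd, Ideal.Quotient.eq_zero_iff_mem]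
    convert Ideal.add_mem _ (Ideal.mul_mem_left _ (Polynomial.C c) m2X)
      (Ideal.mul_mem_left _ q mXX) using 1
    simp only [map_mul, map_zero, map_ofNat]
    ring
  · have hx : (2 : R) ∈ f.range := ofNat_mem _ 2
    have hy : y ∈ f.range := ⟨Ideal.Quotient.mk _ Polynomial.X, gX⟩
    have hM : ∀ r ∈ ({0, 2, y, 2 + y} : Set R), r ∈ f.range := by
      rintro r (rfl | rfl | rfl | rfl)
      exacts [zero_mem _, hx, hy, add_mem hx hy]
    intro r
    rcases h.mem_or_sub_one_mem r with hr | hr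
    · exact hM r hr
    · have := add_mem (hM _ hr) (one_mem _)
      rwa [sub_add_cancel] at this

theorem isSqZeroBasis_zmod_four : IsSqZeroBasis
    (2 : (ZMod 4)[X] ⧸ (Ideal.span {(2 : (ZMod 4)[X]), Polynomial.X}) ^ 2)
    (Ideal.Quotient.mk _ Polynomial.X) := by
  have m2 : (2 : (ZMod 4)[X]) ∈ Ideal.span {(2 : (ZMod 4)[X]), Polynomial.X} :=
    Ideal.subset_span (Or.inl rfl)
  have mX : Polynomial.X ∈ Ideal.span {(2 : (ZMod 4)[X]), Polynomial.X} :=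
    Ideal.subset_span (Or.inr rfl)
  have m22 := Ideal.mul_mem_mul m2 m2
  have m2X := Ideal.mul_mem_mul m2 mX
  have mXX := Ideal.mul_mem_mul mX mX
  rw [← sq, ← Ideal.Quotient.eq_zero_iff_mem, map_mul] at m22 m2X mXX
  rw [map_ofNat] at m22 m2X
  -- Two test maps are needed: `X ↦ 0` into `ZMod 4` detects `2`, and `X ↦ ε` into the dual numbers
  -- over `ZMod 2` detects `X`.
  have hZ : ∀ f ∈ Ideal.span {(2 : (ZMod 4)[X]), Polynomial.X} ^ 2,
      Polynomial.eval₂RingHom (RingHom.id (ZMod 4)) 0 f = 0 :=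
    RingHom.map_eq_zero_of_mem_span_pair_sq _ (by rw [map_ofNat]; decide) (by simp) (by simp)
  have h2D : (2 : DualNumber (ZMod 2)) = 0 := by
    exact (map_ofNat (algebraMap (ZMod 2) (DualNumber (ZMod 2))) 2).symm.trans
      ((congrArg _ (CharTwo.two_eq_zero : (2 : ZMod 2) = 0)).trans (map_zero _))
  obtain ⟨ι⟩ := ZMod.exists_ringHom (R := DualNumber (ZMod 2)) (m := 4) (by
    push_cast; linear_combination 2 * h2D)
  have hD : ∀ f ∈ Ideal.span {(2 : (ZMod 4)[X]), Polynomial.X} ^ 2,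
      Polynomial.eval₂RingHom ι DualNumber.eps f = 0 :=
    RingHom.map_eq_zero_of_mem_span_pair_sq _ (by rw [map_ofNat, h2D, mul_zero])
      (by rw [map_ofNat, h2D, zero_mul]) (by simp)
  have hne : (2 : ZMod 4) ≠ 0 := by decide
  have hε : (DualNumber.eps : DualNumber (ZMod 2)) ≠ 0 := fun e => by
    simpa using congrArg TrivSqZeroExt.snd e
  refine ⟨m22, m2X, mXX, ?_, ?_, fun e => ?_, fun e => ?_, fun e => ?_, fun r => ?_⟩
  · rw [← m22]; ring
  · rw [← m2X]; ring
  · rw [← map_ofNat (Ideal.Quotient.mk _), Ideal.Quotient.eq_zero_iff_mem] at e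
    have := hZ _ e
    rw [map_ofNat] at this
    exact hne this
  · rw [Ideal.Quotient.eq_zero_iff_mem] at e
    exact hε (by simpa using hD _ e)
  · rw [← map_ofNat (Ideal.Quotient.mk _), Ideal.Quotient.mk_eq_mk_iff_sub_mem] at e
    have := hZ _ e
    rw [map_sub, map_ofNat] at this
    exact hne (by simpa using this)
  · obtain ⟨p, rfl⟩ := Ideal.Quotient.mk_surjective r
    obtain ⟨a, b, q, rfl⟩ : ∃ a b q, p = Polynomial.C a + Polynomial.C b * Polynomial.X +
        q * (Polynomial.X * Polynomial.X) := by
      refine ⟨p.coeff 0, p.divX.coeff 0, p.divX.divX, ?_⟩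
      conv_lhs => rw [← p.divX_mul_X_add, ← p.divX.divX_mul_X_add]
      ring
    have hC : Ideal.Quotient.mk (Ideal.span {(2 : (ZMod 4)[X]), Polynomial.X} ^ 2)
        (Polynomial.C 2) = 2 := by rw [map_ofNat, map_ofNat]
    have hM : ∀ a b : ZMod 4, a = 0 ∨ a = 2 → Ideal.Quotient.mk
        (Ideal.span {(2 : (ZMod 4)[X]), Polynomial.X} ^ 2)
        (Polynomial.C a + Polynomial.C b * Polynomial.X) ∈
        ({0, 2, Ideal.Quotient.mk _ Polynomial.X, 2 + Ideal.Quotient.mk _ Polynomial.X} :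
          Set _) := by
      intro a b ha
      have four : ∀ b : ZMod 4, b = 0 ∨ b = 1 ∨ b = 2 ∨ b = 1 + 2 := by decide
      rcases ha with rfl | rfl <;> rcases four b with rfl | rfl | rfl | rfl <;>
        simp [hC, m2X, add_mul]
    have four : ∀ a : ZMod 4, (a = 0 ∨ a = 2) ∨ ∃ e, (e = 0 ∨ e = 2) ∧ a = 1 + e := by decide
    have hq : Ideal.Quotient.mk (Ideal.span {(2 : (ZMod 4)[X]), Polynomial.X} ^ 2)
        (q * (Polynomial.X * Polynomial.X)) = 0 := by
      rw [map_mul, map_mul, mXX, mul_zero]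
    rw [map_add, hq, add_zero]
    rcases four a with ha | ⟨e, he, rfl⟩
    · exact Or.inl (hM a b ha)
    · right
      convert hM e b he using 1
      simp only [map_add, map_one]
      ring

end ZModFour

/-! ### Products of two rings. -/

section Prod

variable {A : Type u} {B : Type v} [CommRing A] [CommRing B]

theorem mem_properZeroDivisors_left [Nontrivial B] {x : A} (hx : x ≠ 0) :
    ((x, 0) : A × B) ∈ properZeroDivisors (A × B) :=
  ⟨fun e => hx (congrArg Prod.fst e), (0, 1), fun e => one_ne_zero (congrArg Prod.snd e),
    by simp⟩

theorem mem_properZeroDivisors_right [Nontrivial A] {y : B} (hy : y ≠ 0) :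
    ((0, y) : A × B) ∈ properZeroDivisors (A × B) :=
  ⟨fun e => hy (congrArg Prod.snd e), (1, 0), fun e => one_ne_zero (congrArg Prod.fst e),
    by simp⟩

/-- Any two edges of a star meet in the centre. -/
theorem not_isStarCenter_of_disjoint_edges {R : Type*} [CommRing R] {p q s t : R} (hp : p ≠ 0)
    (hq : q ≠ 0) (hs : s ≠ 0) (ht : t ≠ 0) (hpq : p * q = 0) (hst : s * t = 0) (npq : p ≠ q)
    (nst : s ≠ t) (hps : p ≠ s) (hpt : p ≠ t) (hqs : q ≠ s) (hqt : q ≠ t) (c : R) :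
    ¬ IsStarCenter c := by
  rintro ⟨-, h⟩
  have mp : p ∈ properZeroDivisors R := ⟨hp, q, hq, hpq⟩
  have mq : q ∈ properZeroDivisors R := ⟨hq, p, hp, by rw [mul_comm, hpq]⟩
  have ms : s ∈ properZeroDivisors R := ⟨hs, t, ht, hst⟩
  have mt : t ∈ properZeroDivisors R := ⟨ht, s, hs, by rw [mul_comm, hst]⟩
  have h1 : p = c ∨ q = c := by
    by_contra! hne
    exact hne.2 ((h p mp hne.1).2 q mq npq.symm hpq)
  have h2 : s = c ∨ t = c := by
    by_contra! hne
    exact hne.2 ((h s ms hne.1).2 t mt nst.symm hst)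
  rcases h1 with rfl | rfl <;> rcases h2 with h2 | h2
  exacts [hps h2.symm, hpt h2.symm, hqs h2.symm, hqt h2.symm]

/-- The graph is complete bipartite, and the alliance is the two-element side `(1, 0)`, `(-1, 0)`. A
third element of `k` supplies the second of two disjoint edges. -/
theorem hasAllianceTwo_zmod_three_prod (k : Type u) [Field k] (hk : Nat.card k ≠ 2) :
    HasAllianceTwo (ZMod 3 × k) := by
  obtain ⟨t, ht0, ht1⟩ : ∃ t : k, t ≠ 0 ∧ t ≠ 1 := by
    by_contra! h
    apply hk
    rw [← Set.ncard_univ, ← Set.ncard_pair (zero_ne_one' k)]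
    congr 1
    ext z
    by_cases hz : z = 0
    · simp [hz]
    · simp [h z hz]
  have h1 : (1 : ZMod 3) ≠ 0 := by decide
  have h2 : (-1 : ZMod 3) ≠ 0 := by decide
  have h12 : (1 : ZMod 3) ≠ -1 := by decide
  have three : ∀ x : ZMod 3, x = 0 ∨ x = 1 ∨ x = -1 := by decide
  refine ⟨⟨(1, 0), (-1, 0), mem_properZeroDivisors_left h1, mem_properZeroDivisors_left h2,
    fun e => h12 (congrArg Prod.fst e), ?_⟩, ?_⟩
  · rintro ⟨x, y⟩ ⟨hv0, ⟨s, t⟩, hst, hmul⟩ hva hvb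
    rw [Prod.mk_mul_mk, Prod.mk_eq_zero] at hmul
    have hy : y ≠ 0 := by
      rintro rfl
      rcases three x with rfl | rfl | rfl
      exacts [hv0 rfl, hva rfl, hvb rfl]
    have ht : t = 0 := (mul_eq_zero.1 hmul.2).resolve_left hy
    have hs : s ≠ 0 := by rintro rfl; exact hst (by rw [ht]; rfl)
    have hx : x = 0 := (mul_eq_zero.1 hmul.1).resolve_right hs
    subst hx
    have none : ∀ w ∈ properZeroDivisors (ZMod 3 × k), ((0, y) : ZMod 3 × k) * w = 0 →
        w ≠ (1, 0) → w ≠ (-1, 0) → False := by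
      rintro ⟨p, q⟩ hw e2 e3 e4
      rw [Prod.mk_mul_mk, Prod.mk_eq_zero] at e2
      have hq : q = 0 := (mul_eq_zero.1 e2.2).resolve_left hy
      subst hq
      rcases three p with rfl | rfl | rfl
      exacts [hw.1 rfl, e3 rfl, e4 rfl]
    exact ⟨Or.inl (by simp), fun w hw _ e2 e3 e4 => (none w hw e2 e3 e4).elim,
      fun w hw _ _ _ e2 e3 e4 => (none w hw e2 e3 e4).elim⟩
  · refine not_isStarCenter_of_disjoint_edges (p := (1, 0)) (q := (0, 1)) (s := (-1, 0))
      (t := (0, t)) ?_ ?_ ?_ ?_ (by simp) (by simp) ?_ ?_ ?_ ?_ ?_ ?_ <;>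
      simp [h1, h12, ht0, ht1.symm]

/-- The alliance is `{(1, 0), (0, x)}`. The remaining vertices are leaves: `(0, u)` with `u` a unit
hangs on `(1, 0)`, and `(1, x)` hangs on `(0, x)`. -/
theorem hasAllianceTwo_zmod_two_prod {x : B} (h : IsPrimeUniformizer 2 x 1) :
    HasAllianceTwo (ZMod 2 × B) := by
  have hx2 : x ^ 2 = 0 := h.pow_eq_zero
  have hx : x ≠ 0 := by simpa using h.pow_ne_zero
  have : Nontrivial B := ⟨x, 0, hx⟩
  have hU := h.isUniformizer
  have hmul : ∀ t, x * t = 0 ∨ x * t = x := by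
    intro t
    rcases h.dvd_or_eq_one_add t with ⟨s, rfl⟩ | ⟨s, rfl⟩
    · left; linear_combination s * hx2
    · right; linear_combination s * hx2
  have two : ∀ z : ZMod 2, z = 0 ∨ z = 1 := by decide
  have h10 : (1 : ZMod 2) ≠ 0 := one_ne_zero
  have hx1 : x ≠ 1 := by
    rintro rfl
    exact hU.not_isUnit isUnit_one
  refine ⟨⟨(1, 0), (0, x), mem_properZeroDivisors_left h10, mem_properZeroDivisors_right hx,
    fun e => h10 (congrArg Prod.fst e), ?_⟩, ?_⟩
  · rintro ⟨p, y⟩ hv hva hvb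
    rcases two p with rfl | rfl
    · have hy : y ≠ 0 := by rintro rfl; exact hv.1 rfl
      have hyu : IsUnit y := by
        refine (hU.isUnit_or_dvd y).resolve_right ?_
        rintro ⟨t, rfl⟩
        rcases hmul t with e | e
        exacts [hy e, hvb (by rw [e])]
      have none : ∀ w ∈ properZeroDivisors (ZMod 2 × B), ((0, y) : ZMod 2 × B) * w = 0 →
          w ≠ (1, 0) → False := by
        rintro ⟨p, q⟩ hw e2 e3
        rw [Prod.mk_mul_mk, Prod.mk_eq_zero] at e2
        have hq : q = 0 := hyu.mul_right_eq_zero.1 e2.2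
        subst hq
        rcases two p with rfl | rfl
        exacts [hw.1 rfl, e3 rfl]
      exact ⟨Or.inl (by simp), fun w hw _ e2 e3 _ => (none w hw e2 e3).elim,
        fun w hw _ _ _ e2 e3 _ => (none w hw e2 e3).elim⟩
    · obtain ⟨-, ⟨s, t⟩, hst, hm⟩ := hv
      rw [Prod.mk_mul_mk, Prod.mk_eq_zero, one_mul] at hm
      obtain ⟨rfl, hm⟩ := hm
      have ht : t ≠ 0 := by rintro rfl; exact hst rfl
      have hy : y = x := by
        have : ¬ IsUnit y := fun hu => ht (hu.mul_right_eq_zero.1 hm)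
        obtain ⟨s, rfl⟩ := (hU.isUnit_or_dvd y).resolve_left this
        rcases hmul s with e | e
        · exact absurd (by rw [e]) hva
        · exact e
      subst hy
      have none : ∀ w ∈ properZeroDivisors (ZMod 2 × B), ((1, y) : ZMod 2 × B) * w = 0 →
          w ≠ (0, y) → False := by
        rintro ⟨p, q⟩ hw e2 e3
        rw [Prod.mk_mul_mk, Prod.mk_eq_zero, one_mul] at e2
        obtain ⟨rfl, e2⟩ := e2
        obtain ⟨s, rfl⟩ := hU.pow_dvd_of_pow_mul_eq_zero (i := 1) (w := q) (by simpa using e2)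
        rw [show y ^ (1 + 1 - 1) = y by simp] at *
        rcases hmul s with e | e
        · exact hw.1 (by rw [e]; rfl)
        · exact e3 (by rw [e])
      exact ⟨Or.inr (by rw [Prod.mk_mul_mk, mul_zero, ← sq, hx2]; rfl),
        fun w hw _ e2 _ e3 => (none w hw e2 e3).elim,
        fun w hw _ _ _ e2 _ e3 => (none w hw e2 e3).elim⟩
  · refine not_isStarCenter_of_disjoint_edges (p := (1, 0)) (q := (0, 1)) (s := (1, x))
      (t := (0, x)) ?_ ?_ ?_ ?_ (by simp) ?_ ?_ ?_ ?_ ?_ ?_ ?_ <;>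
      simp [hx, hx.symm, ← sq, hx2, hx1.symm]

theorem isStarCenter_of_field (hA : ∀ x : A, x ≠ 0 → IsUnit x) [Nontrivial A] [Nontrivial B]
    (hB : ∀ y : B, y = 0 ∨ y = 1) : IsStarCenter ((0, 1) : A × B) := by
  refine ⟨mem_properZeroDivisors_right one_ne_zero, ?_⟩
  rintro ⟨x, y⟩ ⟨hv, ⟨s, t⟩, hst, hm⟩ hne
  rw [Prod.mk_mul_mk, Prod.mk_eq_zero] at hm
  have hy : y = 0 := by
    refine (hB y).resolve_right ?_
    rintro rfl
    rw [one_mul] at hm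
    have hs : s ≠ 0 := fun e => hst (by rw [e, hm.2]; rfl)
    exact hne (by rw [(hA s hs).mul_left_eq_zero.1 hm.1])
  subst hy
  have hx : IsUnit x := hA x fun e => hv (by rw [e]; rfl)
  refine ⟨by simp, ?_⟩
  rintro ⟨p, q⟩ hw - e
  rw [Prod.mk_mul_mk, Prod.mk_eq_zero] at e
  have hp := hx.mul_right_eq_zero.1 e.1
  subst hp
  have hq := (hB q).resolve_left fun e => hw.1 (by rw [e]; rfl)
  rw [hq]

theorem exists_forall_ne_of_card {B : Type*} [Finite B] {c d e : B} (hB : 4 ≤ Nat.card B) :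
    ∃ y, y ≠ c ∧ y ≠ d ∧ y ≠ e := by
  by_contra! h
  have h1 : (Set.univ : Set B) ⊆ {c, d, e} := by
    intro y _
    simp only [Set.mem_insert_iff, Set.mem_singleton_iff]
    tauto
  have h2 := Set.ncard_le_ncard h1
  rw [Set.ncard_univ] at h2
  have h3 : ({c, d, e} : Set B).ncard ≤ 3 := Set.ncard_insert_le c {d, e} |>.trans
    (Nat.succ_le_succ (Set.ncard_insert_le d {e} |>.trans (by rw [Set.ncard_singleton])))
  omega

/-- If `(r, 0)` is outside, so is one of its neighbours `(0, y)`; hence `(r, 0)` is adjacent to both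
members, which must lie in `0 × B`, and uniqueness of the outside neighbour leaves `B = {0, a2, b2,
y}`. Now `(0, y)` has the outside neighbour `(1, 0)`, so `y` annihilates `a2` and `b2`. As `1` is
one of `a2`, `b2`, `y`, this is impossible. -/
theorem IsAlliancePair.isUnit_prod_mem [Nontrivial A] [Nontrivial B] [Finite B] {a b : A × B}
    (h : IsAlliancePair a b) (hB : 4 ≤ Nat.card B) {r : A} (hr : IsUnit r) :
    (r, 0) = a ∨ (r, 0) = b := by
  by_contra! hne
  obtain ⟨a1, a2⟩ := a
  obtain ⟨b1, b2⟩ := b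
  obtain ⟨ha, hb, hab, h⟩ := h
  obtain ⟨-, h2, h3⟩ := h (r, 0) (mem_properZeroDivisors_left hr.ne_zero) hne.1 hne.2
  obtain ⟨y, hy0, hya, hyb⟩ := exists_forall_ne_of_card (c := (0 : B)) (d := a2) (e := b2) hB
  have nb : ∀ y : B, y ≠ 0 → ((0, y) : A × B) ≠ (r, 0) :=
    fun y hy e => hy (congrArg Prod.snd e)
  have nbm : ∀ y : B, ((r, 0) : A × B) * (0, y) = 0 := fun y => by simp
  have nbne : ∀ y c : B, ∀ d : A, y ≠ c → ((0, y) : A × B) ≠ (d, c) :=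
    fun y c d hy e => hy (congrArg Prod.snd e)
  obtain ⟨e1, e2⟩ := h2 (0, y) (mem_properZeroDivisors_right hy0) (nb y hy0) (nbm y)
    (nbne _ _ _ hya) (nbne _ _ _ hyb)
  rw [Prod.mk_mul_mk, Prod.mk_eq_zero, hr.mul_right_eq_zero] at e1 e2
  obtain ⟨rfl, -⟩ := e1
  obtain ⟨rfl, -⟩ := e2
  have ha2 : a2 ≠ 0 := fun e => ha.1 (by rw [e]; rfl)
  have hb2 : b2 ≠ 0 := fun e => hb.1 (by rw [e]; rfl)
  have hall : ∀ z, z ≠ 0 → z ≠ a2 → z ≠ b2 → z = y := fun z hz hza hzb =>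
    congrArg Prod.snd (h3 (0, z) (mem_properZeroDivisors_right hz) (0, y)
      (mem_properZeroDivisors_right hy0) (nb z hz) (nbm z) (nbne _ _ _ hza) (nbne _ _ _ hzb)
      (nb y hy0) (nbm y) (nbne _ _ _ hya) (nbne _ _ _ hyb))
  have n1 : ∀ z : B, ((1, 0) : A × B) ≠ (0, z) := fun z e => one_ne_zero (congrArg Prod.fst e)
  obtain ⟨e1, e2⟩ := (h (0, y) (mem_properZeroDivisors_right hy0) (nbne _ _ _ hya)
    (nbne _ _ _ hyb)).2.1 (1, 0) (mem_properZeroDivisors_left one_ne_zero) (n1 y) (by simp)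
    (n1 _) (n1 _)
  rw [Prod.mk_mul_mk, Prod.mk_eq_zero] at e1 e2
  by_cases h1a : (1 : B) = a2
  · rw [← h1a, mul_one] at e1; exact hy0 e1.2
  by_cases h1b : (1 : B) = b2
  · rw [← h1b, mul_one] at e2; exact hy0 e2.2
  · rw [← hall 1 one_ne_zero h1a h1b, one_mul] at e1
    exact ha2 e1.2

/-- If both factors had four elements, the alliance would be `{(1, 0), (0, 1)}`. But `(x, 0)` and
`(0, y)` with `x`, `y` different from `0` and `1` are adjacent outside vertices, and `(x, 0)` is not
adjacent to `(1, 0)`. -/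
theorem IsAlliancePair.card_lt_four [Nontrivial A] [Nontrivial B] [Finite A] [Finite B]
    {a b : A × B} (h : IsAlliancePair a b) : Nat.card A < 4 ∨ Nat.card B < 4 := by
  by_contra! hc
  have h1 := h.isUnit_prod_mem hc.2 isUnit_one
  have h2 := (h.map (RingEquiv.prodComm (R := A) (S := B))).isUnit_prod_mem hc.1 isUnit_one
  have h2' : ((0, 1) : A × B) = a ∨ ((0, 1) : A × B) = b := by
    rcases h2 with e | e
    · left; exact congrArg Prod.swap e
    · right; exact congrArg Prod.swap e
  have main : ∀ a b : A × B, IsAlliancePair a b → (1, 0) = a → (0, 1) = b → False := by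
    rintro _ _ h rfl rfl
    obtain ⟨x, hx0, hx1, -⟩ := exists_forall_ne_of_card (c := (0 : A)) (d := 1) (e := 1) hc.1
    obtain ⟨y, hy0, hy1, -⟩ := exists_forall_ne_of_card (c := (0 : B)) (d := 1) (e := 1) hc.2
    have := (h.2.2.2 (x, 0) (mem_properZeroDivisors_left hx0)
      (fun e => hx1 (congrArg Prod.fst e)) (fun e => hx0 (congrArg Prod.fst e))).2.1 (0, y)
      (mem_properZeroDivisors_right hy0) (fun e => hy0 (congrArg Prod.snd e)) (by simp)
      (fun e => hy0 (congrArg Prod.snd e)) (fun e => hy1 (congrArg Prod.snd e))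
    exact hx0 (by simpa using congrArg Prod.fst this.1)
  have h01 : ((1, 0) : A × B) ≠ (0, 1) := fun e => one_ne_zero (congrArg Prod.fst e)
  rcases h1 with h1 | h1 <;> rcases h2' with h2 | h2
  · exact h01 (h1.trans h2.symm)
  · exact main a b h h1 h2
  · exact main b a h.symm h1 h2
  · exact h01 (h1.trans h2.symm)

theorem isUnit_of_card_prime {A : Type u} [CommRing A] [Finite A] (hA : (Nat.card A).Prime) {x : A}
    (hx : x ≠ 0) : IsUnit x := by
  let := Fintype.ofFinite A
  rw [Nat.card_eq_fintype_card] at hA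
  have := Fact.mk hA
  let e := ZMod.ringEquivOfPrime A hA rfl
  rw [← e.apply_symm_apply x]
  exact (isUnit_iff_ne_zero.2 ((map_ne_zero_iff e.symm e.symm.injective).2 hx)).map e

theorem eq_zero_or_eq_one_of_card_two {A : Type u} [CommRing A] (hA : Nat.card A = 2)
    (x : A) : x = 0 ∨ x = 1 := by
  have : Finite A := Nat.finite_of_card_ne_zero (by omega)
  have : Nontrivial A := Finite.one_lt_card_iff_nontrivial.1 (by omega)
  have h : ({0, 1} : Set A) = Set.univ :=
    Set.eq_of_subset_of_ncard_le (Set.subset_univ _)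
      (by rw [Set.ncard_univ, hA, Set.ncard_pair zero_ne_one])
  have := Set.mem_univ x
  rw [← h] at this
  exact this

theorem exists_ne_zero_mul_eq_zero_of_not_isUnit [Finite B] {y : B} (hy : ¬ IsUnit y) :
    ∃ t, t ≠ 0 ∧ y * t = 0 := by
  rw [isUnit_iff_mem_nonZeroDivisors_of_finite, mem_nonZeroDivisors_iff_right] at hy
  push Not at hy
  obtain ⟨t, ht, ht0⟩ := hy
  exact ⟨t, ht0, by rw [mul_comm, ht]⟩

/-- For `B` with at least four elements the alliance is `{(1, 0), (-1, 0)}`. A nonzero non-unit `y`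
makes `(1, y)` a vertex adjacent to neither. -/
theorem HasAllianceTwo.isField_of_card_three [Nontrivial B] [Finite A] [Finite B]
    (hA : Nat.card A = 3) (h : HasAllianceTwo (A × B)) : IsField B ∧ Nat.card B ≠ 2 := by
  have : Nontrivial A := Finite.one_lt_card_iff_nontrivial.1 (by omega)
  have hcB : 1 < Nat.card B := Finite.one_lt_card_iff_nontrivial.2 inferInstance
  have hB2 : Nat.card B ≠ 2 := fun hB => h.2 (0, 1) (isStarCenter_of_field
    (fun x hx => isUnit_of_card_prime (by rw [hA]; exact Nat.prime_three) hx)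
    (eq_zero_or_eq_one_of_card_two hB))
  refine ⟨?_, hB2⟩
  have key : ∀ y : B, y ≠ 0 → IsUnit y := by
    intro y hy
    by_cases hB3 : Nat.card B = 3
    · exact isUnit_of_card_prime (by rw [hB3]; exact Nat.prime_three) hy
    have hB4 : 4 ≤ Nat.card B := by omega
    obtain ⟨⟨a, b, hab⟩, -⟩ := h
    by_contra hyu
    obtain ⟨t, ht, hyt⟩ := exists_ne_zero_mul_eq_zero_of_not_isUnit hyu
    have h1 := hab.isUnit_prod_mem hB4 isUnit_one
    have h2 := hab.isUnit_prod_mem hB4 isUnit_one.neg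
    have h3 : ((1, 0) : A × B) ≠ (-1, 0) := by
      intro e
      have e1 : (1 : A) = -1 := congrArg Prod.fst e
      let := Fintype.ofFinite A
      have e2 := Nat.cast_card_eq_zero A
      rw [← Nat.card_eq_fintype_card, hA] at e2
      push_cast at e2
      exact one_ne_zero (α := A) (by linear_combination e2 - e1)
    have hmem : ∀ c : A × B, c = a ∨ c = b → c = (1, 0) ∨ c = (-1, 0) := by
      grind
    have ha := hmem a (Or.inl rfl)
    have hb := hmem b (Or.inr rfl)
    have hv : ∀ c : A × B, c = (1, 0) ∨ c = (-1, 0) → ((1, y) : A × B) ≠ c ∧ (1, y) * c ≠ 0 := by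
      rintro c (rfl | rfl) <;> simp [hy]
    have := (hab.2.2.2 (1, y) ⟨fun e => hy (congrArg Prod.snd e), (0, t),
      fun e => ht (congrArg Prod.snd e), by simp [hyt]⟩ (hv a ha).1 (hv b hb).1).1
    exact this.elim (hv a ha).2 (hv b hb).2
  exact ⟨⟨0, 1, zero_ne_one⟩, mul_comm, fun {y} hy => (key y hy).exists_right_inv⟩

/-- For every `r` the product `c * r` is killed by `c`, so it is `0` or `c`; accordingly `r` or `r -
1` is killed by `c` and hence divisible by it. -/
theorem isPrimeUniformizer_two_of_annihilator {c : B} (hc : c ≠ 0) (hcc : c * c = 0)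
    (h : ∀ t, c * t = 0 → t = 0 ∨ t = c) : IsPrimeUniformizer 2 c 1 := by
  have hdvd : ∀ t, c * t = 0 → c ∣ t := fun t ht => by
    rcases h t ht with rfl | rfl
    exacts [dvd_zero _, dvd_rfl]
  have key : ∀ r, c ∣ r ∨ c ∣ r - 1 := by
    intro r
    rcases h (c * r) (by rw [← mul_assoc, hcc, zero_mul]) with e | e
    · exact Or.inl (hdvd r e)
    · exact Or.inr (hdvd _ (by rw [mul_sub, e, mul_one, sub_self]))
  refine ⟨Nat.prime_two, by rw [sq, hcc], by rwa [pow_one], ?_, fun r => ?_⟩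
  · refine (key _).resolve_right ?_
    rintro ⟨s, hs⟩
    push_cast at hs
    exact hc (by linear_combination c * hs + s * hcc)
  · rcases key r with h | h
    · exact ⟨0, by simpa using h⟩
    · exact ⟨1, by simpa using h⟩

/-- `B` is not a field, since that would give a star, so it has at least four elements and `(1, 0)`
lies in the alliance. Let `b` be the other member. A vertex `(1, y)` with `y ≠ 0` is not adjacent to
`(1, 0)`, so unless it is `b` all its neighbours `(0, t)` equal `b`. -/
theorem HasAllianceTwo.exists_isPrimeUniformizer_of_card_two [Nontrivial B] [Finite A] [Finite B]
    (hA : Nat.card A = 2) (h : HasAllianceTwo (A × B)) : ∃ x : B, IsPrimeUniformizer 2 x 1 := by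
  have : Nontrivial A := Finite.one_lt_card_iff_nontrivial.1 (by omega)
  have hcB : 1 < Nat.card B := Finite.one_lt_card_iff_nontrivial.2 inferInstance
  have hstar := (h.of_ringEquiv (RingEquiv.prodComm (R := A) (S := B))).2 (0, 1)
  obtain ⟨y, hy, hyu⟩ : ∃ y : B, y ≠ 0 ∧ ¬ IsUnit y := by
    by_contra! hall
    exact hstar (isStarCenter_of_field hall (eq_zero_or_eq_one_of_card_two hA))
  have hB4 : 4 ≤ Nat.card B := by
    by_contra hlt
    refine hyu (isUnit_of_card_prime ?_ hy)
    have : Nat.card B = 2 ∨ Nat.card B = 3 := by omega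
    rcases this with e | e <;> rw [e] <;> norm_num
  obtain ⟨b, hab⟩ : ∃ b : A × B, IsAlliancePair (1, 0) b := by
    obtain ⟨⟨a, b, hab⟩, -⟩ := h
    rcases hab.isUnit_prod_mem hB4 isUnit_one with rfl | rfl
    exacts [⟨b, hab⟩, ⟨a, hab.symm⟩]
  obtain ⟨b1, b2⟩ := b
  have key : ∀ y : B, y ≠ 0 → ((1, y) : A × B) ≠ (b1, b2) → ∀ t, t ≠ 0 → y * t = 0 →
      b1 = 0 ∧ y * b2 = 0 ∧ t = b2 := by
    intro y hy hne t ht hyt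
    have hmul : ((1, y) : A × B) * (1, 0) ≠ 0 := by simp
    obtain ⟨h1, h2, -⟩ := hab.2.2.2 (1, y) ⟨fun e => hy (congrArg Prod.snd e), (0, t),
      fun e => ht (congrArg Prod.snd e), by simp [hyt]⟩ (fun e => hy (congrArg Prod.snd e)) hne
    have h1 := h1.resolve_left hmul
    rw [Prod.mk_mul_mk, Prod.mk_eq_zero, one_mul] at h1
    refine ⟨h1.1, h1.2, ?_⟩
    by_contra htb
    exact hmul (h2 (0, t) (mem_properZeroDivisors_right ht) (by simp) (by simp [hyt]) (by simp)
      (fun e => htb (congrArg Prod.snd e))).1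
  obtain ⟨t, ht, hyt⟩ := exists_ne_zero_mul_eq_zero_of_not_isUnit hyu
  -- If such a `(1, y)` exists, then `b = (0, t)`, and `key` applied to `(1, t)` shows that the
  -- annihilator of `t` is `{0, t}`. Otherwise `B` has a single nonzero zero-divisor.
  by_cases hI : ∃ y : B, y ≠ 0 ∧ (∃ t, t ≠ 0 ∧ y * t = 0) ∧ ((1, y) : A × B) ≠ (b1, b2)
  · obtain ⟨y, hy, ⟨t, ht, hyt⟩, hne⟩ := hI
    obtain ⟨rfl, hyb, rfl⟩ := key y hy hne t ht hyt
    have hne' : ((1, t) : A × B) ≠ (0, t) := by simp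
    have hann : ∀ s, t * s = 0 → s = 0 ∨ s = t := fun s hs => by
      by_cases h0 : s = 0
      · exact Or.inl h0
      · exact Or.inr (key t ht hne' s h0 hs).2.2
    refine ⟨t, isPrimeUniformizer_two_of_annihilator ht ?_ hann⟩
    exact (key t ht hne' y hy (by rw [mul_comm, hyt])).2.1
  · push Not at hI
    have hall : ∀ y : B, y ≠ 0 → (∃ t, t ≠ 0 ∧ y * t = 0) → y = b2 :=
      fun y hy ht => congrArg Prod.snd (hI y hy ht)
    have hann : ∀ s, y * s = 0 → s = 0 ∨ s = y := fun s hs => by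
      by_cases h0 : s = 0
      · exact Or.inl h0
      · exact Or.inr ((hall s h0 ⟨y, hy, by rw [mul_comm, hs]⟩).trans
          (hall y hy ⟨t, ht, hyt⟩).symm)
    refine ⟨y, isPrimeUniformizer_two_of_annihilator hy ?_ hann⟩
    rcases hann t hyt with rfl | rfl
    exacts [absurd rfl ht, hyt]

end Prod

/-! ### Idempotents and the splitting of non-local rings. -/

section Split

theorem exists_ringEquiv_prod_of_isIdempotentElem {R : Type u} [CommRing R] {e : R}
    (he : IsIdempotentElem e) (h0 : e ≠ 0) (h1 : e ≠ 1) :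
    Nonempty (R ≃+* (R ⧸ Ideal.span {e}) × (R ⧸ Ideal.span {1 - e})) ∧
      Nontrivial (R ⧸ Ideal.span {e}) ∧ Nontrivial (R ⧸ Ideal.span {1 - e}) := by
  have hcop : IsCoprime (Ideal.span {e}) (Ideal.span {1 - e}) := by
    rw [Ideal.isCoprime_span_singleton_iff]
    exact ⟨1, 1, by ring⟩
  have hbot : Ideal.span {e} * Ideal.span {1 - e} = ⊥ := by
    rw [Ideal.span_singleton_mul_span_singleton, mul_sub, mul_one, he.eq, sub_self,
      Ideal.span_singleton_eq_bot]
  refine ⟨⟨((RingEquiv.quotientBot R).symm.trans (Ideal.quotEquivOfEq hbot.symm)).trans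
    (Ideal.quotientMulEquivQuotientProd _ _ hcop)⟩, ?_, ?_⟩
  · rw [Ideal.Quotient.nontrivial_iff, Ne, Ideal.span_singleton_eq_top]
    intro hu
    exact h1 (hu.mul_left_cancel (he.eq.trans (mul_one e).symm))
  · rw [Ideal.Quotient.nontrivial_iff, Ne, Ideal.span_singleton_eq_top]
    intro hu
    refine h0 ((hu.mul_right_eq_zero (b := e)).1 ?_)
    rw [sub_mul, one_mul, he.eq, sub_self]

/-- The powers of `r` are eventually periodic; an exponent that is a multiple of the period `d + 1`
and at least the preperiod `i` gives an idempotent. -/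
theorem exists_pow_isIdempotentElem {R : Type u} [CommRing R] [Finite R] (r : R) :
    ∃ n, n ≠ 0 ∧ IsIdempotentElem (r ^ n) := by
  obtain ⟨i, j, hij, e⟩ : ∃ i j, i < j ∧ r ^ i = r ^ j := by
    obtain ⟨i, j, hij, e⟩ := Finite.exists_ne_map_eq_of_infinite (fun n : ℕ => r ^ n)
    rcases lt_or_gt_of_ne hij with h | h
    · exact ⟨i, j, h, e⟩
    · exact ⟨j, i, h, e.symm⟩
  obtain ⟨d, rfl⟩ := Nat.exists_eq_add_of_lt hij
  have key : ∀ m, r ^ (i + m * (d + 1)) = r ^ i := by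
    intro m
    induction m with
    | zero => simp
    | succ m ih =>
      calc r ^ (i + (m + 1) * (d + 1)) = r ^ (i + m * (d + 1)) * r ^ (d + 1) := by ring
        _ = r ^ i := by rw [ih, ← pow_add, ← add_assoc, ← e]
  refine ⟨(i + 1) * (d + 1), by positivity, ?_⟩
  have h := key (i + 1)
  have hle : i ≤ (i + 1) * (d + 1) := by nlinarith
  obtain ⟨k, hk⟩ := Nat.exists_eq_add_of_le hle
  unfold IsIdempotentElem
  rw [hk] at h ⊢
  calc r ^ (i + k) * r ^ (i + k) = r ^ (i + (i + k)) * r ^ k := by ring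
    _ = r ^ (i + k) := by rw [h]; ring

theorem isLocalRing_or_exists_isIdempotentElem (R : Type u) [CommRing R] [Finite R]
    [Nontrivial R] : IsLocalRing R ∨ ∃ e : R, IsIdempotentElem e ∧ e ≠ 0 ∧ e ≠ 1 := by
  by_cases h : ∃ e : R, IsIdempotentElem e ∧ e ≠ 0 ∧ e ≠ 1
  · exact Or.inr h
  left
  push Not at h
  refine IsLocalRing.of_isUnit_or_isUnit_one_sub_self fun r => ?_
  obtain ⟨n, hn, he⟩ := exists_pow_isIdempotentElem r
  by_cases h0 : r ^ n = 0
  · right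
    exact IsNilpotent.isUnit_one_sub ⟨n, h0⟩
  · left
    exact (isUnit_pow_iff hn).1 (by rw [h _ he h0]; exact isUnit_one)

end Split

/-! ### The structure of local rings with an alliance of two elements. -/

section LocalRing

variable {R : Type u} [CommRing R]

theorem mem_properZeroDivisors_iff_not_isUnit [Finite R] {x : R} :
    x ∈ properZeroDivisors R ↔ x ≠ 0 ∧ ¬ IsUnit x := by
  refine and_congr_right fun _ => ⟨?_, exists_ne_zero_mul_eq_zero_of_not_isUnit⟩
  rintro ⟨y, hy, h⟩ hu
  exact hy (hu.mul_right_eq_zero.1 h)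

/-- Lagrange for `aR` inside the annihilator of `v`. For `a` in the socle this makes annihilators of
non-units multiples of the residue field order. -/
theorem ncard_range_dvd_ncard_annihilator {a v : R} (h : a * v = 0) :
    (Set.range (a * ·)).ncard ∣ {w | v * w = 0}.ncard := by
  have hle : (AddMonoidHom.mulLeft a).range ≤ (AddMonoidHom.mulLeft v).ker := by
    rintro _ ⟨r, rfl⟩
    change v * (a * r) = 0
    linear_combination r * h
  exact AddSubgroup.card_dvd_of_le hle

theorem exists_intCast_sub_not_isUnit [IsLocalRing R] [Finite R] {p : ℕ} (hp : p.Prime)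
    (h : Nat.card R = {x : R | ¬ IsUnit x}.ncard * p) :
    ¬ IsUnit (p : R) ∧ ∀ r : R, ∃ c : ℤ, ¬ IsUnit (r - c) := by
  have h1 := Submodule.card_eq_card_quotient_mul_card (IsLocalRing.maximalIdeal R)
  have h2 : Nat.card (IsLocalRing.maximalIdeal R) = {x : R | ¬ IsUnit x}.ncard := rfl
  have hpos : 0 < Nat.card (IsLocalRing.maximalIdeal R) := Nat.card_pos
  have h3 : Nat.card (R ⧸ IsLocalRing.maximalIdeal R) = p := by
    rw [h, ← h2] at h1
    exact (Nat.eq_of_mul_eq_mul_left hpos h1).symm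
  have : Finite (R ⧸ IsLocalRing.maximalIdeal R) :=
    Finite.of_surjective _ Ideal.Quotient.mk_surjective
  let := Fintype.ofFinite (R ⧸ IsLocalRing.maximalIdeal R)
  rw [Nat.card_eq_fintype_card] at h3
  let e := ZMod.ringEquivOfPrime _ hp h3
  refine ⟨?_, fun r => ?_⟩
  · change (p : R) ∈ IsLocalRing.maximalIdeal R
    rw [← Ideal.Quotient.eq_zero_iff_mem, map_natCast, ← h3, Nat.cast_card_eq_zero]
  · obtain ⟨c, hc⟩ := ZMod.intCast_surjective (e.symm (Ideal.Quotient.mk _ r))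
    refine ⟨c, ?_⟩
    change r - c ∈ IsLocalRing.maximalIdeal R
    rw [← Ideal.Quotient.eq_zero_iff_mem, map_sub, map_intCast, sub_eq_zero]
    have := congrArg e hc
    rw [map_intCast, e.apply_symm_apply] at this
    exact this.symm

theorem isPrimeUniformizer_of_forall_dvd [IsLocalRing R] [Finite R] {p n : ℕ} (hp : p.Prime)
    (h : Nat.card R = {x : R | ¬ IsUnit x}.ncard * p) {x : R} (hx : ∀ r, ¬ IsUnit r → x ∣ r)
    (h0 : x ^ (n + 1) = 0) (h1 : x ^ n ≠ 0) : IsPrimeUniformizer p x n := by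
  obtain ⟨h2, h3⟩ := exists_intCast_sub_not_isUnit hp h
  exact ⟨hp, h0, h1, hx _ h2, fun r => (h3 r).imp fun c hc => hx _ hc⟩

/-- Take `z` with the largest annihilator. If `z * v ≠ 0`, then `z * v` has the same annihilator as
`z`, so no power of `v` kills `z`, although `v` is nilpotent. -/
theorem exists_ne_zero_forall_not_isUnit_mul_eq_zero [IsLocalRing R] [Finite R] :
    ∃ z : R, z ≠ 0 ∧ ∀ v, ¬ IsUnit v → z * v = 0 := by
  obtain ⟨z, hz, hmax⟩ := Set.exists_max_image {z : R | z ≠ 0} (fun z => {w | z * w = 0}.ncard)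
    (Set.toFinite _) ⟨1, one_ne_zero⟩
  refine ⟨z, hz, fun v hv => ?_⟩
  by_contra hzv
  have hsub : {w | z * w = 0} ⊆ {w | z * v * w = 0} := fun w (hw : z * w = 0) => by
    change z * v * w = 0
    linear_combination v * hw
  have heq := Set.eq_of_subset_of_ncard_le hsub (hmax _ hzv)
  obtain ⟨n, hn⟩ : IsNilpotent v := by
    obtain ⟨n, hn, he⟩ := exists_pow_isIdempotentElem v
    refine ⟨n, ?_⟩
    have hu : IsUnit (1 - v ^ n) := by
      refine (IsLocalRing.isUnit_or_isUnit_one_sub_self (v ^ n)).resolve_left fun h => hv ?_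
      exact (isUnit_pow_iff hn).1 h
    refine hu.mul_right_eq_zero.1 ?_
    rw [sub_mul, one_mul, he.eq, sub_self]
  have key : ∀ k, z * v ^ k ≠ 0 := by
    intro k
    induction k with
    | zero => simpa using hz
    | succ k ih =>
      intro h
      apply ih
      have : v ^ k ∈ {w | z * v * w = 0} := by
        change z * v * v ^ k = 0
        rw [← h]; ring
      rw [← heq] at this
      exact this
  exact key n (by rw [hn, mul_zero])

theorem not_isUnit_add [IsLocalRing R] {x y : R} (hx : ¬ IsUnit x) (hy : ¬ IsUnit y) :
    ¬ IsUnit (x + y) := (IsLocalRing.maximalIdeal R).add_mem (a := x) (b := y) hx hy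

theorem not_isUnit_sub [IsLocalRing R] {x y : R} (hx : ¬ IsUnit x) (hy : ¬ IsUnit y) :
    ¬ IsUnit (x - y) := (IsLocalRing.maximalIdeal R).sub_mem (a := x) (b := y) hx hy

theorem setOf_mul_eq_zero_eq_of_socle {z : R} (hz : z ≠ 0) (hs : ∀ v, ¬ IsUnit v → z * v = 0) :
    {w | z * w = 0} = {w | ¬ IsUnit w} := by
  ext w
  exact ⟨fun hw hu => hz (hu.mul_left_eq_zero.1 hw), hs w⟩

/-- A socle element outside the alliance forces the maximal ideal to have four or five elements
and square zero. -/
theorem IsAlliancePair.sq_zero_of_socle [IsLocalRing R] [Finite R] {a b z : R}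
    (hab : IsAlliancePair a b) (hstar : ¬ IsStarCenter z) (hz : z ≠ 0)
    (hs : ∀ v, ¬ IsUnit v → z * v = 0) (hza : z ≠ a) (hzb : z ≠ b) :
    ({x : R | ¬ IsUnit x}.ncard = 4 ∨ {x : R | ¬ IsUnit x}.ncard = 5) ∧
      ∀ x y : R, ¬ IsUnit x → ¬ IsUnit y → x * y = 0 := by
  obtain ⟨ha, hb, hne, h⟩ := hab
  have hzV : z ∈ properZeroDivisors R := ⟨hz, a, ha.1, hs a
    (mem_properZeroDivisors_iff_not_isUnit.1 ha).2⟩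
  have h3 := (h z hzV hza hzb).2.2
  have hVz : ∀ w ∈ properZeroDivisors R, z * w = 0 :=
    fun w hw => hs w (mem_properZeroDivisors_iff_not_isUnit.1 hw).2
  by_cases hw : ∃ w ∈ properZeroDivisors R, w ≠ a ∧ w ≠ b ∧ w ≠ z
  · obtain ⟨w, hw, hwa, hwb, hwz⟩ := hw
    have hN : {x : R | ¬ IsUnit x} = {0, a, b, z, w} := by
      ext x
      simp only [Set.mem_ofPred_eq, Set.mem_insert_iff, Set.mem_singleton_iff]
      constructor
      · intro hx
        by_contra! hc
        have hxV := mem_properZeroDivisors_iff_not_isUnit.2 ⟨hc.1, hx⟩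
        exact hc.2.2.2.2 (h3 x hxV w hw hc.2.2.2.1 (hVz x hxV) hc.2.1 hc.2.2.1 hwz (hVz w hw)
          hwa hwb)
      · rintro (rfl | rfl | rfl | rfl | rfl)
        · exact not_isUnit_zero
        all_goals exact (mem_properZeroDivisors_iff_not_isUnit.1 ‹_›).2
    have hcard : {x : R | ¬ IsUnit x}.ncard = 5 := by
      have := ha.1
      have := hb.1
      have := hw.1
      rw [hN, Set.ncard_insert_of_notMem, Set.ncard_insert_of_notMem, Set.ncard_insert_of_notMem,
        Set.ncard_pair hwz.symm] <;>
        simp only [Set.mem_insert_iff, Set.mem_singleton_iff, not_or] <;> tauto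
    refine ⟨Or.inr hcard, fun x y hx hy => ?_⟩
    -- A group of prime order is generated by `z`, so the whole maximal ideal lies in the socle.
    have hc : Nat.card (IsLocalRing.maximalIdeal R) = 5 := hcard
    have : Fact (Nat.Prime 5) := ⟨Nat.prime_five⟩
    have hmem := mem_zmultiples_of_prime_card hc
      (g := (⟨z, (mem_properZeroDivisors_iff_not_isUnit.1 hzV).2⟩ : IsLocalRing.maximalIdeal R))
      (g' := ⟨x, hx⟩) (fun e => hz (congrArg Subtype.val e))
    obtain ⟨n, hn⟩ := hmem
    have hn' : n • z = x := congrArg Subtype.val hn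
    rw [← hn', smul_mul_assoc, hs y hy, smul_zero]
  · push Not at hw
    have hN : {x : R | ¬ IsUnit x} = {0, a, b, z} := by
      ext x
      simp only [Set.mem_ofPred_eq, Set.mem_insert_iff, Set.mem_singleton_iff]
      constructor
      · intro hx
        by_contra! hc
        exact hc.2.2.2 (hw x (mem_properZeroDivisors_iff_not_isUnit.2 ⟨hc.1, hx⟩) hc.2.1 hc.2.2.1)
      · rintro (rfl | rfl | rfl | rfl)
        · exact not_isUnit_zero
        all_goals exact (mem_properZeroDivisors_iff_not_isUnit.1 ‹_›).2
    have hcard : {x : R | ¬ IsUnit x}.ncard = 4 := by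
      have := ha.1
      have := hb.1
      rw [hN, Set.ncard_insert_of_notMem, Set.ncard_insert_of_notMem,
        Set.ncard_pair hzb.symm] <;>
        simp only [Set.mem_insert_iff, Set.mem_singleton_iff, not_or] <;> tauto
    have hV : ∀ v ∈ properZeroDivisors R, v = a ∨ v = b ∨ v = z := by
      intro v hv
      have hvN : v ∈ {x : R | ¬ IsUnit x} := (mem_properZeroDivisors_iff_not_isUnit.1 hv).2
      rw [hN] at hvN
      exact hvN.resolve_left hv.1
    -- Otherwise the graph is the path `a`, `z`, `b`, a star with centre `z`.
    have hmul : a * b = 0 := by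
      by_contra hab0
      refine hstar ⟨hzV, fun v hv hvz => ⟨by rw [mul_comm]; exact hVz v hv, fun w hw' hwv e => ?_⟩⟩
      rcases hV v hv with rfl | rfl | rfl
      · rcases hV w hw' with rfl | rfl | rfl
        exacts [absurd rfl hwv, absurd e hab0, rfl]
      · rcases hV w hw' with rfl | rfl | rfl
        exacts [absurd (by rw [mul_comm]; exact e) hab0, absurd rfl hwv, rfl]
      · exact absurd rfl hvz
    have hza0 : z * a = 0 := hVz a ha
    have hzb0 : z * b = 0 := hVz b hb
    have hzz : z * z = 0 := hVz z hzV
    have hsum : a + b = 0 ∨ a + b = z := by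
      have : a + b ∈ {x : R | ¬ IsUnit x} := not_isUnit_add
        (mem_properZeroDivisors_iff_not_isUnit.1 ha).2
        (mem_properZeroDivisors_iff_not_isUnit.1 hb).2
      rw [hN] at this
      rcases this with e | e | e | e
      · exact Or.inl e
      · exact absurd (by simpa using e) hb.1
      · exact absurd (by simpa using e) ha.1
      · exact Or.inr e
    have haa : a * a = 0 := by
      rcases hsum with e | e
      · linear_combination a * e - hmul
      · linear_combination a * e - hmul + hza0
    have hbb : b * b = 0 := by
      rcases hsum with e | e
      · linear_combination b * e - hmul
      · linear_combination b * e - hmul + hzb0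
    refine ⟨Or.inl hcard, fun x y hx hy => ?_⟩
    have hx : x ∈ {x : R | ¬ IsUnit x} := hx
    have hy : y ∈ {x : R | ¬ IsUnit x} := hy
    rw [hN] at hx hy
    rcases hx with rfl | rfl | rfl | rfl <;> rcases hy with rfl | rfl | rfl | rfl <;> grind

/-- If `a` and `b` were the only vertices, the socle element `a` would be the centre of a star. -/
theorem IsAlliancePair.exists_ne [Finite R] {a b : R}
    (hab : IsAlliancePair a b) (hstar : ¬ IsStarCenter a)
    (hs : ∀ v, ¬ IsUnit v → a * v = 0) : ∃ v ∈ properZeroDivisors R, v ≠ a ∧ v ≠ b := by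
  by_contra! hc
  refine hstar ⟨hab.1, fun v hv hva => ⟨?_, fun w hw hwv _ => ?_⟩⟩
  · rw [mul_comm]; exact hs v (mem_properZeroDivisors_iff_not_isUnit.1 hv).2
  · by_contra hwa
    exact hwv ((hc w hw hwa).trans (hc v hv hva).symm)

theorem dvd_of_ncard_range_eq [Finite R] {v : R} (hv : ¬ IsUnit v)
    (h : (Set.range (v * ·)).ncard = {x : R | ¬ IsUnit x}.ncard) :
    ∀ r, ¬ IsUnit r → v ∣ r := by
  have hsub : Set.range (v * ·) ⊆ {x : R | ¬ IsUnit x} := by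
    rintro _ ⟨r, rfl⟩ hu
    exact hv (isUnit_of_mul_isUnit_left hu)
  have heq := Set.eq_of_subset_of_ncard_le hsub h.ge
  intro r hr
  have : r ∈ {x : R | ¬ IsUnit x} := hr
  rw [← heq] at this
  obtain ⟨s, rfl⟩ := this
  exact dvd_mul_right v s

theorem not_isUnit_of_mul_eq_zero {x y : R} (hy : y ≠ 0) (h : x * y = 0) : ¬ IsUnit x :=
  fun hu => hy (hu.mul_right_eq_zero.1 h)

/-- The case of a socle with three elements. -/
theorem IsAlliancePair.exists_isPrimeUniformizer_three [IsLocalRing R] [Finite R] {a b : R}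
    (hab : IsAlliancePair a b) (hstar : ¬ IsStarCenter a)
    (hs : ∀ z : R, (∀ v, ¬ IsUnit v → z * v = 0) → z = 0 ∨ z = a ∨ z = b)
    (ha : ∀ v, ¬ IsUnit v → a * v = 0) (hb : ∀ v, ¬ IsUnit v → b * v = 0) :
    ∃ x : R, IsPrimeUniformizer 3 x 2 := by
  have ha0 := hab.1.1
  have hb0 := hab.2.1.1
  have hne := hab.2.2.1
  have hsum : a + b = 0 := by
    rcases hs (a + b) (fun v hv => by rw [add_mul, ha v hv, hb v hv, add_zero]) with e | e | e
    · exact e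
    · exact absurd (by simpa using e) hb0
    · exact absurd (by simpa using e) ha0
  have hdouble : a * 2 = b := by
    rcases hs (a * 2) (fun v hv => by linear_combination 2 * ha v hv) with e | e | e
    · exact absurd (by linear_combination e - hsum) hne
    · exact absurd (by linear_combination e) ha0
    · exact e
  have hrange : Set.range (a * ·) = {0, a, b} := by
    ext x
    constructor
    · rintro ⟨r, rfl⟩
      exact hs (a * r) fun v hv => by linear_combination r * ha v hv
    · rintro (rfl | rfl | rfl)
      exacts [⟨0, mul_zero _⟩, ⟨1, mul_one _⟩, ⟨2, hdouble⟩]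
  have hrc : (Set.range (a * ·)).ncard = 3 := by
    rw [hrange, Set.ncard_insert_of_notMem, Set.ncard_pair hne]
    simp [ha0.symm, hb0.symm]
  have hcard := card_eq_ncard_annihilator_mul_ncard_range a
  rw [setOf_mul_eq_zero_eq_of_socle ha0 ha, hrc] at hcard
  have key : ∀ v ∈ properZeroDivisors R, v ≠ a → v ≠ b → ∀ r, ¬ IsUnit r → v ∣ r := by
    intro v hv hva hvb
    have hvu := (mem_properZeroDivisors_iff_not_isUnit.1 hv).2
    apply dvd_of_ncard_range_eq hvu
    have hdvd := ncard_range_dvd_ncard_annihilator (ha v hvu)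
    rw [hrc] at hdvd
    -- Besides `0`, `a`, `b`, `v` only one outside neighbour of `v` is allowed. A positive multiple
    -- of three that is at most five equals three, so `vR` has the size of the maximal ideal.
    have hle : {w | v * w = 0}.ncard ≤ 5 := by
      have h3 := (hab.2.2.2 v hv hva hvb).2.2
      have hle1 : ({w | v * w = 0} \ {0, a, b, v}).ncard ≤ 1 := by
        rw [Set.ncard_le_one_iff]
        rintro w w' ⟨hw, hw'⟩ ⟨hx, hx'⟩
        simp only [Set.mem_insert_iff, Set.mem_singleton_iff, not_or] at hw' hx'
        have mem : ∀ w, v * w = 0 → w ≠ 0 → w ∈ properZeroDivisors R := fun w hw h0 =>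
          ⟨h0, v, hv.1, by rw [mul_comm]; exact hw⟩
        exact h3 w (mem w hw hw'.1) w' (mem w' hx hx'.1) hw'.2.2.2 hw hw'.2.1 hw'.2.2.1
          hx'.2.2.2 hx hx'.2.1 hx'.2.2.1
      have h4 : ({0, a, b, v} : Set R).ncard ≤ 4 := by
        refine (Set.ncard_insert_le _ _).trans (Nat.succ_le_succ ?_)
        refine (Set.ncard_insert_le _ _).trans (Nat.succ_le_succ ?_)
        exact (Set.ncard_insert_le _ _).trans (Nat.succ_le_succ (Set.ncard_singleton v).le)
      have := Set.ncard_le_ncard_sdiff_add_ncard {w | v * w = 0} {0, a, b, v}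
      omega
    have hpos : 0 < {w | v * w = 0}.ncard := (Set.ncard_pos).2 ⟨0, mul_zero v⟩
    have h3 : {w | v * w = 0}.ncard = 3 := by omega
    have hcv := card_eq_ncard_annihilator_mul_ncard_range v
    rw [h3] at hcv
    omega
  obtain ⟨x, hx, hxa, hxb⟩ := hab.exists_ne hstar ha
  have hxd := key x hx hxa hxb
  have hxu := (mem_properZeroDivisors_iff_not_isUnit.1 hx).2
  have hxS : ¬ ∀ v, ¬ IsUnit v → x * v = 0 := by
    intro h
    rcases hs x h with e | e | e
    exacts [hx.1 e, hxa e, hxb e]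
  have hx2 : x ^ 2 ≠ 0 := by
    intro h2
    apply hxS
    intro v hv
    obtain ⟨s, rfl⟩ := hxd v hv
    linear_combination s * h2
  have hx2u : ¬ IsUnit (x ^ 2) := fun h => hxu ((isUnit_pow_iff two_ne_zero).1 h)
  -- If not, `x ^ 2` also generates the maximal ideal, and `x = x ^ 2 * s` forces `x = 0`.
  have hx2S : x ^ 2 = a ∨ x ^ 2 = b := by
    by_contra! hc
    obtain ⟨s, hs⟩ := key (x ^ 2) (mem_properZeroDivisors_iff_not_isUnit.2 ⟨hx2, hx2u⟩) hc.1 hc.2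
      x hxu
    have hu : IsUnit (1 - x * s) := by
      refine (IsLocalRing.isUnit_or_isUnit_one_sub_self (x * s)).resolve_left fun h => hxu ?_
      exact isUnit_of_mul_isUnit_left h
    exact hx.1 (hu.mul_left_eq_zero.1 (by linear_combination hs))
  have hx3 : x ^ 3 = 0 := by
    rcases hx2S with e | e
    · rw [pow_succ, e]; exact ha x hxu
    · rw [pow_succ, e]; exact hb x hxu
  exact ⟨x, isPrimeUniformizer_of_forall_dvd Nat.prime_three hcard hxd hx3 hx2⟩

/-- In a chain ring with an alliance of two elements, the nilpotency index is at most four. -/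
theorem IsAlliancePair.index_le_three {a b x : R} {n : ℕ}
    (hab : IsAlliancePair a b) (hU : IsUniformizer x n) (hxa : x * a = 0) : n ≤ 3 := by
  by_contra! hn
  obtain ⟨m, rfl⟩ := Nat.exists_eq_add_of_le hn
  have hx0 : x ^ (3 + 1 + m + 1) = 0 := hU.pow_eq_zero
  have hxn := hU.pow_ne_zero
  have hne : ∀ i ≤ 3 + 1 + m, x ^ i ≠ 0 := by
    intro i hi h0
    apply hxn
    rw [← Nat.add_sub_of_le hi, pow_add, h0, zero_mul]
  have hunit : ∀ s, IsUnit (1 + x * s) := by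
    intro s
    rw [add_comm]
    exact IsNilpotent.isUnit_add_one ⟨_, by rw [mul_pow, hx0, zero_mul]⟩
  have hmul : ∀ i ≤ 3 + 1 + m, ∀ s, x ^ i * (1 + x * s) ≠ 0 := fun i hi s h =>
    hne i hi ((hunit s).mul_left_eq_zero.1 h)
  have hVmem : ∀ i < 3 + 1 + m, ∀ s, x ^ (i + 1) * (1 + x * s) ∈ properZeroDivisors R := by
    intro i hi s
    refine ⟨hmul _ hi s, x ^ (3 + 1 + m), hxn, ?_⟩
    linear_combination x ^ i * (1 + x * s) * hx0
  -- With `n = 4 + m`, the exponent is `n - 1`. The choices `t = 0` and `t = 1` differ by `x ^ n ≠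
  -- 0`, so one of them avoids `b`.
  obtain ⟨t, ht⟩ : ∃ t, x ^ (2 + m + 1) * (1 + x * t) ≠ b := by
    by_contra! hc
    refine hxn ?_
    linear_combination hc 1 - hc 0
  have hva : x ^ (2 + m + 1) * (1 + x * t) ≠ a := by
    intro e
    apply hmul (3 + 1 + m) le_rfl t
    linear_combination x * e + hxa
  have h3 := (hab.2.2.2 _ (hVmem (2 + m) (by omega) t) hva ht).2.2
  have cand : ∀ s s', x ^ (1 + 1) * (1 + x * s) ≠ b → x ^ (1 + 1) * (1 + x * s') ≠ b →
      x ^ (1 + 1) * (1 + x * s) = x ^ (1 + 1) * (1 + x * s') := by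
    have ca : ∀ s, x ^ (1 + 1) * (1 + x * s) ≠ a := by
      intro s e
      apply hmul 3 (by omega) s
      linear_combination x * e + hxa
    have cv : ∀ s, x ^ (1 + 1) * (1 + x * s) ≠ x ^ (2 + m + 1) * (1 + x * t) := by
      intro s e
      apply hmul 4 (by omega) s
      linear_combination x ^ 2 * e + (1 + x * t) * hx0
    have c0 : ∀ s, x ^ (2 + m + 1) * (1 + x * t) * (x ^ (1 + 1) * (1 + x * s)) = 0 := by
      intro s
      linear_combination (1 + x * t) * (1 + x * s) * hx0
    intro s s' hs hs'
    exact h3 _ (hVmem 1 (by omega) s) _ (hVmem 1 (by omega) s') (cv s) (c0 s) (ca s) hs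
      (cv s') (c0 s') (ca s') hs'
  -- The three elements given by `0`, `1` and `x` are distinct neighbours of the chosen vertex; at
  -- most one is `b`, so two remain outside.
  have d1 : x ^ (1 + 1) * (1 + x * 0) ≠ x ^ (1 + 1) * (1 + x * 1) := fun e =>
    hne 3 (by omega) (by linear_combination -e)
  have d2 : x ^ (1 + 1) * (1 + x * 0) ≠ x ^ (1 + 1) * (1 + x * x) := fun e =>
    hne 4 (by omega) (by linear_combination -e)
  have d3 : x ^ (1 + 1) * (1 + x * 1) ≠ x ^ (1 + 1) * (1 + x * x) := fun e =>
    hmul 3 (by omega) (-1) (by linear_combination e)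
  by_cases e0 : x ^ (1 + 1) * (1 + x * 0) = b
  · exact d3 (cand 1 x (by rw [← e0]; exact d1.symm) (by rw [← e0]; exact d2.symm))
  by_cases e1 : x ^ (1 + 1) * (1 + x * 1) = b
  · exact d2 (cand 0 x e0 (by rw [← e1]; exact d3.symm))
  · exact d1 (cand 0 1 e0 e1)

/-- The case of a socle with two elements. -/
theorem IsAlliancePair.exists_isPrimeUniformizer_two [IsLocalRing R] [Finite R] {a b : R}
    (hab : IsAlliancePair a b) (hstar : ¬ IsStarCenter a)
    (hs : ∀ z : R, (∀ v, ¬ IsUnit v → z * v = 0) → z = 0 ∨ z = a)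
    (ha : ∀ v, ¬ IsUnit v → a * v = 0) :
    ∃ x : R, IsPrimeUniformizer 2 x 3 := by
  have ha0 := hab.1.1
  have hne := hab.2.2.1
  have hbu := (mem_properZeroDivisors_iff_not_isUnit.1 hab.2.1).2
  have hb : ¬ ∀ v, ¬ IsUnit v → b * v = 0 := by
    intro h
    rcases hs b h with e | e
    exacts [hab.2.1.1 e, hne e.symm]
  have hrange : Set.range (a * ·) = {0, a} := by
    ext x
    constructor
    · rintro ⟨r, rfl⟩
      exact hs (a * r) fun v hv => by linear_combination r * ha v hv
    · rintro (rfl | rfl)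
      exacts [⟨0, mul_zero _⟩, ⟨1, mul_one _⟩]
  have hrc : (Set.range (a * ·)).ncard = 2 := by
    rw [hrange, Set.ncard_pair ha0.symm]
  have hcard := card_eq_ncard_annihilator_mul_ncard_range a
  rw [setOf_mul_eq_zero_eq_of_socle ha0 ha, hrc] at hcard
  -- If every other non-unit killed `b`, then so would `b = v + (b - v)`, and `b` would lie in the
  -- socle.
  obtain ⟨x, hx, hxa, hxb, hxb0⟩ : ∃ x ∈ properZeroDivisors R, x ≠ a ∧ x ≠ b ∧ x * b ≠ 0 := by
    by_contra! hc
    obtain ⟨v, hv, hva, hvb⟩ := hab.exists_ne hstar ha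
    have hvu := (mem_properZeroDivisors_iff_not_isUnit.1 hv).2
    have hall : ∀ w, ¬ IsUnit w → w ≠ b → w * b = 0 := by
      intro w hw hwb
      by_cases h0 : w = 0
      · rw [h0, zero_mul]
      by_cases hwa : w = a
      · rw [hwa]; exact ha b hbu
      · exact hc w (mem_properZeroDivisors_iff_not_isUnit.2 ⟨h0, hw⟩) hwa hwb
    apply hb
    intro w hw
    by_cases hwb : w = b
    · have h1 := hall v hvu hvb
      have h2 := hall (b - v) (not_isUnit_sub hbu hvu) (by simpa using hv.1)
      rw [hwb]
      linear_combination h1 + h2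
    · rw [mul_comm]; exact hall w hw hwb
  have hxu := (mem_properZeroDivisors_iff_not_isUnit.1 hx).2
  have hxa0 : x * a = 0 := by rw [mul_comm]; exact ha x hxu
  -- As `x` is not adjacent to `b`, it has no outside neighbour. The annihilator has even order at
  -- most three, hence order two, so `x` generates the maximal ideal.
  have hann : {w | x * w = 0} ⊆ {0, a, x} := by
    intro w hw
    by_contra hc
    simp only [Set.mem_insert_iff, Set.mem_singleton_iff, not_or] at hc
    have hw : x * w = 0 := hw
    refine hxb0 ((hab.2.2.2 x hx hxa hxb).2.1 w ⟨hc.1, x, hx.1, by rw [mul_comm]; exact hw⟩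
      hc.2.2 hw hc.2.1 ?_).2
    rintro rfl
    exact hxb0 hw
  have hann2 : {w | x * w = 0}.ncard = 2 := by
    have hdvd := ncard_range_dvd_ncard_annihilator (ha x hxu)
    rw [hrc] at hdvd
    have h3 : ({0, a, x} : Set R).ncard ≤ 3 :=
      (Set.ncard_insert_le _ _).trans (Nat.succ_le_succ
        ((Set.ncard_insert_le _ _).trans (Nat.succ_le_succ (Set.ncard_singleton x).le)))
    have hle := (Set.ncard_le_ncard hann).trans h3
    have hpos : 0 < {w | x * w = 0}.ncard := (Set.ncard_pos).2 ⟨0, mul_zero x⟩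
    omega
  have hann' : ∀ w, x * w = 0 → w = 0 ∨ w = a := by
    have hsub : ({0, a} : Set R) ⊆ {w | x * w = 0} := by
      rintro w (rfl | rfl)
      exacts [mul_zero x, hxa0]
    have heq := Set.eq_of_subset_of_ncard_le hsub (by rw [hann2, Set.ncard_pair ha0.symm])
    intro w hw
    have : w ∈ {w | x * w = 0} := hw
    rw [← heq] at this
    exact this
  have hxd : ∀ r, ¬ IsUnit r → x ∣ r := by
    apply dvd_of_ncard_range_eq hxu
    have hcv := card_eq_ncard_annihilator_mul_ncard_range x
    rw [hann2] at hcv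
    omega
  obtain ⟨n, hn0, hn1⟩ : ∃ n, x ^ (n + 1) = 0 ∧ x ^ n ≠ 0 := by
    have hnil : ∃ n, x ^ n = 0 := by
      obtain ⟨n, hn, he⟩ := exists_pow_isIdempotentElem x
      refine ⟨n, ?_⟩
      have hu : IsUnit (1 - x ^ n) := by
        refine (IsLocalRing.isUnit_or_isUnit_one_sub_self (x ^ n)).resolve_left fun h => hxu ?_
        exact (isUnit_pow_iff hn).1 h
      refine hu.mul_right_eq_zero.1 ?_
      rw [sub_mul, one_mul, he.eq, sub_self]
    classical
    have hpos : Nat.find hnil ≠ 0 := by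
      intro e
      have := Nat.find_spec hnil
      rw [e, pow_zero] at this
      exact one_ne_zero this
    obtain ⟨n, hn⟩ := Nat.exists_eq_succ_of_ne_zero hpos
    refine ⟨n, ?_, Nat.find_min hnil (by omega)⟩
    have := Nat.find_spec hnil
    rwa [hn] at this
  have hP := isPrimeUniformizer_of_forall_dvd Nat.prime_two hcard hxd hn0 hn1
  have hle := hab.index_le_three hP.isUniformizer hxa0
  have hn3 : n = 3 := by
    interval_cases n
    · exact absurd (by simpa using hn0) hx.1
    · rcases hann' x (by rw [← sq]; exact hn0) with e | e
      exacts [absurd e hx.1, absurd e hxa]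
    -- For `n = 2` every vertex other than `a` is a unit multiple of `x`, with sole neighbour `a`: a
    -- star.
    · refine absurd ⟨hab.1, fun v hv hva => ⟨?_, fun w hw _ hvw => ?_⟩⟩ hstar
      · rw [mul_comm]; exact ha v (mem_properZeroDivisors_iff_not_isUnit.1 hv).2
      · obtain ⟨s, rfl⟩ := hxd v (mem_properZeroDivisors_iff_not_isUnit.1 hv).2
        have hsu : IsUnit s := by
          by_contra hsu
          obtain ⟨t, rfl⟩ := hxd s hsu
          rcases hann' (x * (x * t)) (by linear_combination t * hn0) with e | e
          exacts [hv.1 e, hva e]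
        refine (hann' w ?_).resolve_left hw.1
        rw [← hsu.mul_right_eq_zero, ← hvw]
        ring
    · rfl
  rw [hn3] at hP
  exact ⟨x, hP⟩

/-- The residue field order is the size of `zR`, at least two and a divisor of the order of the
maximal ideal. If it is `4` or `5`, then `z` generates that ideal; if it is `2`, the ideal is a
plane over `ℤ/2`, whose first basis vector is chosen to be `2` unless `2 = 0`. -/
theorem exists_uniformizer_or_sqZeroBasis [IsLocalRing R] [Finite R] {z : R} (hz : z ≠ 0)
    (hzu : ¬ IsUnit z) (hN : {x : R | ¬ IsUnit x}.ncard = 4 ∨ {x : R | ¬ IsUnit x}.ncard = 5)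
    (hmul : ∀ x y : R, ¬ IsUnit x → ¬ IsUnit y → x * y = 0) :
    (∃ x : R, IsUniformizer x 1 ∧ Nat.card R = 16) ∨ (∃ x : R, IsPrimeUniformizer 5 x 1) ∨
      ∃ x y : R, IsSqZeroBasis x y ∧ ((2 : R) = 0 ∨ x = 2) := by
  have hs : ∀ v, ¬ IsUnit v → z * v = 0 := fun v hv => hmul z v hzu hv
  have hann := setOf_mul_eq_zero_eq_of_socle hz hs
  have hcard := card_eq_ncard_annihilator_mul_ncard_range z
  have hdvd := ncard_range_dvd_ncard_annihilator (hs z hzu)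
  rw [hann] at hcard hdvd
  have h2 : 2 ≤ (Set.range (z * ·)).ncard := by
    rw [← Set.ncard_pair hz]
    refine Set.ncard_le_ncard ?_
    rintro w (rfl | rfl)
    exacts [⟨1, mul_one _⟩, ⟨0, mul_zero _⟩]
  have hz2 : z ^ (1 + 1) = 0 := by rw [sq]; exact hs z hzu
  have hz1 : z ^ 1 ≠ 0 := by rwa [pow_one]
  rcases hN with hN | hN
  · have hr : (Set.range (z * ·)).ncard = 2 ∨ (Set.range (z * ·)).ncard = 4 := by
      rw [hN] at hdvd
      have hle := Nat.le_of_dvd (by norm_num) hdvd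
      generalize (Set.range (z * ·)).ncard = c at h2 hdvd hle ⊢
      interval_cases c <;> omega
    rcases hr with hr | hr
    · right; right
      rw [hr] at hcard
      obtain ⟨h2u, hres⟩ := exists_intCast_sub_not_isUnit Nat.prime_two hcard
      push_cast at h2u
      have hadd : ∀ x : R, ¬ IsUnit x → x + x = 0 := fun x hx => by
        rw [← two_mul]; exact hmul 2 x h2u hx
      have hres' : ∀ r : R, ¬ IsUnit r ∨ ¬ IsUnit (r - 1) := by
        intro r
        by_contra! hc
        obtain ⟨c, hc'⟩ := hres r
        rcases Int.even_or_odd' c with ⟨d, rfl | rfl⟩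
        · have : ¬ IsUnit (2 * (d : R)) := fun h => h2u (isUnit_of_mul_isUnit_left h)
          refine not_isUnit_add hc' this ?_
          push_cast
          rw [sub_add_cancel]
          exact hc.1
        · have : ¬ IsUnit (2 * (d : R)) := fun h => h2u (isUnit_of_mul_isUnit_left h)
          refine not_isUnit_add hc' this ?_
          push_cast
          convert hc.2 using 1
          ring
      have basis : ∀ x y : R, ¬ IsUnit x → ¬ IsUnit y → x ≠ 0 → y ≠ 0 → x ≠ y →
          IsSqZeroBasis x y := by
        intro x y hx hy hx0 hy0 hxy
        have hsum : x + y ≠ 0 := fun e => hxy (by linear_combination e - hadd y hy)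
        have h5 : x ≠ x + y := by simpa using hy0
        have h6 : y ≠ x + y := by simpa using hx0
        have h4 : ({0, x, y, x + y} : Set R).ncard = 4 := by
          rw [Set.ncard_insert_of_notMem, Set.ncard_insert_of_notMem, Set.ncard_pair h6] <;>
            simp only [Set.mem_insert_iff, Set.mem_singleton_iff, not_or] <;> tauto
        have hsub : ({0, x, y, x + y} : Set R) ⊆ {x : R | ¬ IsUnit x} := by
          rintro w (rfl | rfl | rfl | rfl)
          exacts [not_isUnit_zero, hx, hy, not_isUnit_add hx hy]
        have heq := Set.eq_of_subset_of_ncard_le hsub (by rw [h4, hN])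
        refine ⟨hmul x x hx hx, hmul x y hx hy, hmul y y hy hy, hadd x hx, hadd y hy, hx0, hy0,
          hxy, fun r => ?_⟩
        rw [heq]
        exact hres' r
      have pick : ∀ x : R, ∃ y, ¬ IsUnit y ∧ y ≠ 0 ∧ x ≠ y := by
        intro x
        by_contra! hc
        have hsub : {x : R | ¬ IsUnit x} ⊆ {0, x} := by
          intro y hy
          by_cases h0 : y = 0
          · exact Or.inl h0
          · exact Or.inr (hc y hy h0).symm
        have h1 := Set.ncard_le_ncard hsub
        have h3 : ({0, x} : Set R).ncard ≤ 2 :=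
          (Set.ncard_insert_le _ _).trans (Nat.succ_le_succ (Set.ncard_singleton x).le)
        omega
      by_cases h20 : (2 : R) = 0
      · obtain ⟨y, hy, hy0, hzy⟩ := pick z
        exact ⟨z, y, basis z y hzu hy hz hy0 hzy, Or.inl h20⟩
      · obtain ⟨y, hy, hy0, h2y⟩ := pick 2
        exact ⟨2, y, basis 2 y h2u hy h20 hy0 h2y, Or.inr rfl⟩
    · left
      have hd := dvd_of_ncard_range_eq hzu (hr.trans hN.symm)
      refine ⟨z, ⟨hz2, hz1, fun r => ?_⟩, by rw [hcard, hN, hr]⟩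
      by_cases hu : IsUnit r
      · exact Or.inl hu
      · exact Or.inr (hd r hu)
  · right; left
    have hr : (Set.range (z * ·)).ncard = 5 := by
      rw [hN] at hdvd
      rcases (Nat.dvd_prime Nat.prime_five).1 hdvd with e | e
      · omega
      · exact e
    have hd := dvd_of_ncard_range_eq hzu (hr.trans hN.symm)
    rw [hr] at hcard
    exact ⟨z, isPrimeUniformizer_of_forall_dvd Nat.prime_five hcard hd hz2 hz1⟩

theorem HasAllianceTwo.structure_of_isLocalRing [IsLocalRing R] [Finite R]
    (h : HasAllianceTwo R) :
    (∃ x : R, IsPrimeUniformizer 2 x 3) ∨ (∃ x : R, IsPrimeUniformizer 3 x 2) ∨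
      (∃ x : R, IsUniformizer x 1 ∧ Nat.card R = 16) ∨ (∃ x : R, IsPrimeUniformizer 5 x 1) ∨
      ∃ x y : R, IsSqZeroBasis x y ∧ ((2 : R) = 0 ∨ x = 2) := by
  obtain ⟨⟨a, b, hab⟩, hstar⟩ := h
  obtain ⟨z, hz, hs⟩ := exists_ne_zero_forall_not_isUnit_mul_eq_zero (R := R)
  by_cases hA : ∃ z : R, z ≠ 0 ∧ (∀ v, ¬ IsUnit v → z * v = 0) ∧ z ≠ a ∧ z ≠ b
  · obtain ⟨z, hz, hs, hza, hzb⟩ := hA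
    obtain ⟨hN, hmul⟩ := hab.sq_zero_of_socle (hstar z) hz hs hza hzb
    have hzu : ¬ IsUnit z := not_isUnit_of_mul_eq_zero hab.1.1
      (hs a (mem_properZeroDivisors_iff_not_isUnit.1 hab.1).2)
    exact Or.inr (Or.inr (exists_uniformizer_or_sqZeroBasis hz hzu hN hmul))
  · push Not at hA
    have main : ∀ b, IsAlliancePair z b →
        (∀ w : R, (∀ v, ¬ IsUnit v → w * v = 0) → w = 0 ∨ w = z ∨ w = b) →
        (∃ x : R, IsPrimeUniformizer 2 x 3) ∨ ∃ x : R, IsPrimeUniformizer 3 x 2 := by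
      intro b hzb hS
      by_cases hb : ∀ v, ¬ IsUnit v → b * v = 0
      · exact Or.inr (hzb.exists_isPrimeUniformizer_three (hstar z) hS hs hb)
      · refine Or.inl (hzb.exists_isPrimeUniformizer_two (hstar z) (fun w hw => ?_) hs)
        rcases hS w hw with e | e | rfl
        exacts [Or.inl e, Or.inr e, absurd hw hb]
    have hS : ∀ w : R, (∀ v, ¬ IsUnit v → w * v = 0) → w = 0 ∨ w = a ∨ w = b := by
      intro w hw
      by_cases h0 : w = 0
      · exact Or.inl h0
      by_cases hwa : w = a
      · exact Or.inr (Or.inl hwa)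
      · exact Or.inr (Or.inr (hA w h0 hw hwa))
    have hza : z = a ∨ z = b := (hS z hs).resolve_left hz
    have : (∃ x : R, IsPrimeUniformizer 2 x 3) ∨ ∃ x : R, IsPrimeUniformizer 3 x 2 := by
      rcases hza with rfl | rfl
      · exact main b hab hS
      · exact main a hab.symm fun w hw => (hS w hw).imp_right Or.symm
    exact this.elim Or.inl fun h => Or.inr (Or.inl h)

end LocalRing

/-! ### The list of rings. -/

section Classification

variable {R : Type u} [CommRing R]

theorem nonempty_ringEquiv_zmod_two_prod {A : Type u} {B : Type v} [CommRing A] [CommRing B]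
    (hA : Nat.card A = 2) {x : B} (hx : IsPrimeUniformizer 2 x 1) (e : R ≃+* A × B) :
    Nonempty (R ≃+* ZMod 2 × ZMod 4) ∨
      Nonempty (R ≃+* ZMod 2 × ((ZMod 2)[X] ⧸ Ideal.span {(Polynomial.X : (ZMod 2)[X]) ^ 2})) := by
  have : Finite A := Nat.finite_of_card_ne_zero (by omega)
  let := Fintype.ofFinite A
  let f := ZMod.ringEquivOfPrime A Nat.prime_two (by rw [← Nat.card_eq_fintype_card, hA])
  rcases hx.classification_sq with ⟨⟨g⟩⟩ | ⟨⟨g⟩⟩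
  · exact Or.inl ⟨e.trans (RingEquiv.prodCongr f.symm g)⟩
  · exact Or.inr ⟨e.trans (RingEquiv.prodCongr f.symm g)⟩

theorem HasAllianceTwo.classification_of_ringEquiv_prod {A B : Type u} [CommRing A] [CommRing B]
    [Nontrivial A] [Nontrivial B] [Finite A] [Finite B] (hA : Nat.card A < 4)
    (h : HasAllianceTwo (A × B)) (e : R ≃+* A × B) :
    (∃ (k : Type u) (_ : Field k), Nat.card k ≠ 2 ∧ Nonempty (R ≃+* ZMod 3 × k)) ∨
      Nonempty (R ≃+* ZMod 2 × ZMod 4) ∨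
      Nonempty (R ≃+* ZMod 2 × ((ZMod 2)[X] ⧸ Ideal.span {(Polynomial.X : (ZMod 2)[X]) ^ 2})) := by
  have h1 : 1 < Nat.card A := Finite.one_lt_card_iff_nontrivial.2 inferInstance
  have h23 : Nat.card A = 3 ∨ Nat.card A = 2 := by omega
  rcases h23 with hA | hA
  · left
    obtain ⟨hf, hB⟩ := h.isField_of_card_three hA
    let := Fintype.ofFinite A
    let f := ZMod.ringEquivOfPrime A Nat.prime_three (by rw [← Nat.card_eq_fintype_card, hA])
    exact ⟨B, hf.toField, hB, ⟨e.trans (RingEquiv.prodCongr f.symm (RingEquiv.refl B))⟩⟩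
  · right
    obtain ⟨x, hx⟩ := h.exists_isPrimeUniformizer_of_card_two hA
    exact nonempty_ringEquiv_zmod_two_prod hA hx e

theorem HasAllianceTwo.classification_of_not_isLocalRing [Finite R] [Nontrivial R]
    (hR : ¬ IsLocalRing R) (h : HasAllianceTwo R) :
    (∃ (k : Type u) (_ : Field k), Nat.card k ≠ 2 ∧ Nonempty (R ≃+* ZMod 3 × k)) ∨
      Nonempty (R ≃+* ZMod 2 × ZMod 4) ∨
      Nonempty (R ≃+* ZMod 2 × ((ZMod 2)[X] ⧸ Ideal.span {(Polynomial.X : (ZMod 2)[X]) ^ 2})) := by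
  obtain ⟨e, he, h0, h1⟩ := (isLocalRing_or_exists_isIdempotentElem R).resolve_left hR
  obtain ⟨⟨f⟩, hA, hB⟩ := exists_ringEquiv_prod_of_isIdempotentElem he h0 h1
  have : Finite (R ⧸ Ideal.span {e}) := Finite.of_surjective _ Ideal.Quotient.mk_surjective
  have : Finite (R ⧸ Ideal.span {1 - e}) := Finite.of_surjective _ Ideal.Quotient.mk_surjective
  have hAB := h.of_ringEquiv f
  obtain ⟨⟨a, b, hab⟩, -⟩ := id hAB
  rcases hab.card_lt_four with hc | hc
  · exact hAB.classification_of_ringEquiv_prod hc f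
  · exact (hAB.of_ringEquiv RingEquiv.prodComm).classification_of_ringEquiv_prod hc
      (f.trans RingEquiv.prodComm)

end Classification

theorem mainTheorem2 (R : Type u) [CommRing R] [Finite R] :
    (zeroDivisorGraph R).globalOffensiveAllianceNumber = 2 ↔
      (∃ (k : Type u) (_ : Field k), Nat.card k ≠ 2 ∧ Nonempty (R ≃+* ZMod 3 × k)) ∨
      Nonempty (R ≃+* ZMod 2 × ZMod 4) ∨
      Nonempty (R ≃+* ZMod 2 × ((ZMod 2)[X] ⧸ Ideal.span {(Polynomial.X : (ZMod 2)[X]) ^ 2})) ∨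
      Nonempty (R ≃+* ZMod 16) ∨
      Nonempty (R ≃+* (ZMod 2)[X] ⧸ Ideal.span {(Polynomial.X : (ZMod 2)[X]) ^ 4}) ∨
      Nonempty (R ≃+* (ZMod 4)[X] ⧸
        Ideal.span {2 * (Polynomial.X : (ZMod 4)[X]), Polynomial.X ^ 3 - 2}) ∨
      Nonempty (R ≃+* (ZMod 4)[X] ⧸ Ideal.span {(Polynomial.X : (ZMod 4)[X]) ^ 2 - 2}) ∨
      Nonempty (R ≃+* (ZMod 4)[X] ⧸
        Ideal.span {(Polynomial.X : (ZMod 4)[X]) ^ 2 + 2 * Polynomial.X + 2}) ∨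
      Nonempty (R ≃+* (GaloisField 2 2)[X] ⧸
        Ideal.span {(Polynomial.X : (GaloisField 2 2)[X]) ^ 2}) ∨
      Nonempty (R ≃+* (ZMod 4)[X] ⧸
        Ideal.span {(Polynomial.X : (ZMod 4)[X]) ^ 2 + Polynomial.X + 1}) ∨
      Nonempty (R ≃+* MvPolynomial (Fin 2) (ZMod 2) ⧸
        (Ideal.span {(MvPolynomial.X 0 : MvPolynomial (Fin 2) (ZMod 2)), MvPolynomial.X 1}) ^ 2) ∨
      Nonempty (R ≃+* (ZMod 4)[X] ⧸
        (Ideal.span {(2 : (ZMod 4)[X]), Polynomial.X}) ^ 2) ∨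
      Nonempty (R ≃+* ZMod 27) ∨
      Nonempty (R ≃+* (ZMod 3)[X] ⧸ Ideal.span {(Polynomial.X : (ZMod 3)[X]) ^ 3}) ∨
      Nonempty (R ≃+* (ZMod 9)[X] ⧸
        (Ideal.span {Polynomial.X ^ 2 - 3, 3 * Polynomial.X} : Ideal (ZMod 9)[X])) ∨
      Nonempty (R ≃+* (ZMod 9)[X] ⧸
        (Ideal.span {Polynomial.X ^ 2 - 6, 3 * Polynomial.X} : Ideal (ZMod 9)[X])) ∨
      Nonempty (R ≃+* ZMod 25) ∨
      Nonempty (R ≃+* (ZMod 5)[X] ⧸ Ideal.span {(Polynomial.X : (ZMod 5)[X]) ^ 2}) := by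
  rw [globalOffensiveAllianceNumber_zeroDivisorGraph_eq_two_iff]
  constructor
  · intro h
    have : Nontrivial R := by
      obtain ⟨⟨a, b, hab⟩, -⟩ := h
      exact ⟨a, b, hab.2.2.1⟩
    by_cases hR : IsLocalRing R
    · rcases h.structure_of_isLocalRing with ⟨x, hx⟩ | ⟨x, hx⟩ | ⟨x, hx, hc⟩ | ⟨x, hx⟩ |
        ⟨x, y, hxy, h2 | rfl⟩
      · have := hx.classification_two
        tauto
      · have := hx.classification_three
        tauto
      · have := hx.classification_sixteen hc
        tauto
      · have : Nonempty (R ≃+* ZMod 25) ∨ _ := hx.classification_sq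
        tauto
      · have := hxy.nonempty_ringEquiv_mvPolynomial h2
        tauto
      · have := hxy.nonempty_ringEquiv_zmod_four
        tauto
    · exact (h.classification_of_not_isLocalRing hR).imp_right fun h => h.imp_right Or.inl
  · rintro (⟨k, _, hk, ⟨e⟩⟩ | ⟨⟨e⟩⟩ | ⟨⟨e⟩⟩ | ⟨⟨e⟩⟩ | ⟨⟨e⟩⟩ | ⟨⟨e⟩⟩ | ⟨⟨e⟩⟩ | ⟨⟨e⟩⟩ | ⟨⟨e⟩⟩ | ⟨⟨e⟩⟩ |
      ⟨⟨e⟩⟩ | ⟨⟨e⟩⟩ | ⟨⟨e⟩⟩ | ⟨⟨e⟩⟩ | ⟨⟨e⟩⟩ | ⟨⟨e⟩⟩ | ⟨⟨e⟩⟩ | ⟨⟨e⟩⟩) <;>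
      have := Finite.of_equiv _ e.toEquiv <;> refine HasAllianceTwo.of_ringEquiv ?_ e.symm
    · exact hasAllianceTwo_zmod_three_prod k hk
    · exact hasAllianceTwo_zmod_two_prod (isPrimeUniformizer_zmod Nat.prime_two 1)
    · exact hasAllianceTwo_zmod_two_prod (isPrimeUniformizer_quotient_X_pow Nat.prime_two 1)
    · exact (isPrimeUniformizer_zmod Nat.prime_two 3).hasAllianceTwo_two
    · exact (isPrimeUniformizer_quotient_X_pow Nat.prime_two 3).hasAllianceTwo_two
    · exact isPrimeUniformizer_two_X_cube_sub_two.hasAllianceTwo_two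
    · exact isPrimeUniformizer_two_X_sq_sub_two.hasAllianceTwo_two
    · exact isPrimeUniformizer_two_X_sq_add_two_mul_X_add_two.hasAllianceTwo_two
    · exact (isUniformizer_quotient_X_sq (GaloisField 2 2)).hasAllianceTwo
        (Or.inl natCard_quotient_galoisField_X_sq)
    · exact isUniformizer_quotient_X_sq_add_X_add_one.hasAllianceTwo
        (Or.inl natCard_quotient_X_sq_add_X_add_one)
    · exact isSqZeroBasis_mvPolynomial.hasAllianceTwo
    · exact isSqZeroBasis_zmod_four.hasAllianceTwo
    · exact (isPrimeUniformizer_zmod Nat.prime_three 2).hasAllianceTwo_three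
    · exact (isPrimeUniformizer_quotient_X_pow Nat.prime_three 2).hasAllianceTwo_three
    · exact isPrimeUniformizer_three_X_sq_sub_three.hasAllianceTwo_three
    · exact isPrimeUniformizer_three_X_sq_sub_six.hasAllianceTwo_three
    · exact (isPrimeUniformizer_zmod Nat.prime_five 1).isUniformizer.hasAllianceTwo
        (Or.inr (Nat.card_zmod 25))
    · refine (isPrimeUniformizer_quotient_X_pow Nat.prime_five 1).isUniformizer.hasAllianceTwo
        (Or.inr ?_)
      have : Fact (Nat.Prime 5) := ⟨Nat.prime_five⟩
      rw [natCard_quotient_span_monic (Polynomial.monic_X_pow 2), Nat.card_zmod,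
        Polynomial.natDegree_X_pow]
      norm_num
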